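/- Let $G$ be a real Lie group, not necessarily connected, with complexified Lie algebra $\mathfrak g$, and let $\langle\,,\rangle$ be a nondegenerate symmetric $G$-invariant complex bilinear form on $\mathfrak g$. Let $M$ be a smooth $G$-manifold (without boundary), and let $\Omega(M)$ be its complexified de Rham algebra, on which $g\in G$ acts by $g\cdot\omega=(g^{-1})^*\omega$ and $a\in\mathfrak g$ acts by the contraction $i_a$ with the vector field $x\mapsto \frac{d}{dt}\big|_{0}\exp(-ta)\cdot x$ (extended complex linearly in $a$), contraction being in the first slot. All tensor products are algebraic and over $\mathbb C$. *The basic subspace.* Let $\mathrm{Cl}(\mathfrak g)$ be the Clifford algebra with relations $2x^2=\langle x,x\rangle$ for $x\in\mathfrak g$, identified with $\wedge(\mathfrak g)$ as a vector space by the symbol map, and let $\mathcal W(\mathfrak g)=U(\mathfrak g)\otimes\mathrm{Cl}(\mathfrak g)$, with the adjoint action of $G$, the parity coming from $\mathrm{Cl}(\mathfrak g)$, and the contractions $i_a=I\otimes\bar i_a$, where $\bar i_a$ is the super-derivation of $\wedge(\mathfrak g)$ with $\bar i_a b=\langle a,b\rangle$ for $b\in\mathfrak g$. Let $(\mathcal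 W(\mathfrak g)\otimes\Omega(M))_G$ be the space of basic elements, that is, of the $G$-invariant elements that are annihilated by $i_a\otimes 1+\epsilon\otimes i_a$ for all $a\in\mathfrak g$, where $\epsilon$ is the parity operator ($\pm1$) of $\mathcal W(\mathfrak g)$. *The map $\Theta$.* For a $G$-manifold $N$ let $(U(\mathfrak g)\otimes\Omega(N))^G$ be the space of $G$-invariants, with the adjoint action of $G$ on $U(\mathfrak g)$. Let $\Theta:\mathcal W(\mathfrak g)\otimes\Omega(M)\to U(\mathfrak g)\otimes\Omega(M)$ be the map induced by the augmentation $\mathrm{Cl}(\mathfrak g)\simeq\wedge(\mathfrak g)\to\mathbb C$. *The map $\mu$.* Let $M_G=G\times^G M$ be the quotient manifold of $G\times M$ by the action $k\cdot(g,m)=(gk^{-1},k\cdot m)$ of $G$, with projection $p:G\times M\to M_G$ and with the action of $G$ by left multiplication on the first factor, and let $\mu:M_G\to M$, $[g,m]\mapsto g\cdot m$, be the action map, which is smooth and $G$-equivariant. *The map $\psi_M$.* Let $\psi_M:U(\mathfrak g)\otimes\Omega(M_G)\to\mathcal W(\mathfrak g)\otimes\Omega(M)$ be the map $x\otimes\omega\mapsto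 x\otimes\omega(1)$. Here $\omega(1)\in\wedge(\mathfrak g^*)\otimes\Omega(M)\simeq\wedge(\mathfrak g)\otimes\Omega(M)$ (the isomorphism being induced by $\langle\,,\rangle$) is the evaluation of $p^*\omega$ along $1\times M$: for a basis $e_1,\dots,e_d$ of $\mathfrak g$ with dual basis $e_1^*,\dots,e_d^*$, $$\omega(1)=\sum_{s_1<\cdots<s_q}e_{s_1}^*\wedge\cdots\wedge e_{s_q}^*\otimes \bigl((p^*\omega)(e_{s_1},\dots,e_{s_q},\,\cdot\,)\bigr)\big|_{1\times M},$$ where the $e_i$ are regarded as left invariant vector fields on the factor $G$. Then $\mu^*:\Omega(M)\to\Omega(M_G)$ is a map of $G$-modules, and $\Theta$, $I\otimes\mu^*$ and $\psi_M$ restrict to maps $$\Theta:(\mathcal W(\mathfrak g)\otimes\Omega(M))_G\to(U(\mathfrak g)\otimes\Omega(M))^G,$$ $$(U(\mathfrak g)\otimes\Omega(M))^G\xrightarrow{\;I\otimes\mu^*\;}(U(\mathfrak g)\otimes\Omega(M_G))^G\xrightarrow{\;\psi_M\;}(\mathcal W(\mathfrak g)\otimes\Omega(M))_G .$$ The first two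 of these are bijective, and the inverse of $\Theta$ is $\psi_M\circ(I\otimes\mu^*)$: the composites $\psi_M\circ(I\otimes\mu^*)\circ\Theta$ and $\Theta\circ\psi_M\circ(I\otimes\mu^*)$ are the identity maps of $(\mathcal W(\mathfrak g)\otimes\Omega(M))_G$ and of $(U(\mathfrak g)\otimes\Omega(M))^G$. -/

import Mathlib

set_option linter.unusedSectionVars false

open scoped Manifold ContDiff TensorProduct DirectSum Bundle

noncomputable section

namespace EquivCoh

section Forms

variable {E : Type*} [NormedAddCommGroup E] [NormedSpace ℝ E]
  {H : Type*} [TopologicalSpace H] (I : ModelWithCorners ℝ E H)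
  (M : Type*) [TopologicalSpace M] [ChartedSpace H M] [IsManifold I ∞ M]

/-- Smoothness of a family of complex valued alternating forms on the tangent spaces: in the chart
at every point, the components of the form with respect to the coordinate vector fields are smooth
functions. -/
def IsSmoothForm {n : ℕ} (w : (x : M) → (TangentSpace I x) [⋀^Fin n]→ₗ[ℝ] ℂ) : Prop :=
  ∀ (x₀ : M) (v : Fin n → E),
    ContMDiffOn I 𝓘(ℝ, ℂ) ∞
      (fun x => w x fun i => (trivializationAt E (TangentSpace I : M → Type _) x₀).symm x (v i))
      (chartAt H x₀).source

/-- The space of smooth complex valued differential forms of degree `n`. -/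
def DiffForm (n : ℕ) : Submodule ℂ ((x : M) → (TangentSpace I x) [⋀^Fin n]→ₗ[ℝ] ℂ) where
  carrier := {w | IsSmoothForm I M w}
  add_mem' := fun ha hb x₀ v => (ha x₀ v).add (hb x₀ v)
  zero_mem' := fun _ _ => contMDiffOn_const
  smul_mem' := fun c _ ha x₀ v =>
    ((contDiff_const_smul c).contMDiff (n := ∞)).comp_contMDiffOn (ha x₀ v)

/-- The complexified de Rham algebra, as a graded vector space. -/
def Omega : Type _ := ⨁ n : ℕ, DiffForm I M n

instance : AddCommGroup (Omega I M) := inferInstanceAs (AddCommGroup (⨁ n : ℕ, DiffForm I M n))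

instance : Module ℂ (Omega I M) := inferInstanceAs (Module ℂ (⨁ n : ℕ, DiffForm I M n))

variable {M} in
/-- The inclusion of the forms of degree `n` into all forms. -/
def ofDeg (n : ℕ) : DiffForm I M n →ₗ[ℂ] Omega I M :=
  DirectSum.lof ℂ ℕ (fun k => DiffForm I M k) n

variable {I M} in
/-- A linear map on forms is given by its values on the homogeneous ones. -/
def liftDeg {X : Type*} [AddCommGroup X] [Module ℂ X] (f : (n : ℕ) → DiffForm I M n →ₗ[ℂ] X) :
    Omega I M →ₗ[ℂ] X :=
  DirectSum.toModule ℂ ℕ X f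

variable {I M}

theorem liftDeg_ofDeg {X : Type*} [AddCommGroup X] [Module ℂ X]
    (f : (n : ℕ) → DiffForm I M n →ₗ[ℂ] X) (n : ℕ) (w : DiffForm I M n) :
    liftDeg f (ofDeg I n w) = f n w :=
  DirectSum.toModule_lof (M := fun k => DiffForm I M k) (φ := f) ℂ n w

theorem omega_hom_ext {X : Type*} [AddCommGroup X] [Module ℂ X] {f g : Omega I M →ₗ[ℂ] X}
    (h : ∀ (n : ℕ) (w : DiffForm I M n), f (ofDeg I n w) = g (ofDeg I n w)) : f = g :=
  DirectSum.linearMap_ext ℂ fun n => LinearMap.ext fun w => h n w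

variable {E' : Type*} [NormedAddCommGroup E'] [NormedSpace ℝ E']
  {H' : Type*} [TopologicalSpace H'] {I' : ModelWithCorners ℝ E' H'}
  {M' : Type*} [TopologicalSpace M'] [ChartedSpace H' M'] [IsManifold I' ∞ M']

/-- Evaluating a smooth form on smooth vector fields along a smooth map gives a smooth function. -/
theorem contMDiffAt_form_apply [FiniteDimensional ℝ E'] {n : ℕ} (w : DiffForm I' M' n) {g : M → M'} {x₀ : M}
    (W : Fin n → (x : M) → TangentSpace I' (g x))
    (hW : ∀ i, ContMDiffAt I I'.tangent ∞ (fun x => (⟨g x, W i x⟩ : TangentBundle I' M')) x₀)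
    (hg : ContMDiffAt I I' ∞ g x₀) :
    ContMDiffAt I 𝓘(ℝ, ℂ) ∞ (fun x => w.1 (g x) fun i => W i x) x₀ := by
  classical
  let e := trivializationAt E' (TangentSpace I' : M' → Type _) (g x₀)
  let b := Module.finBasis ℝ E'
  have hmem : ∀ᶠ x in nhds x₀, g x ∈ e.baseSet :=
    hg.continuousAt.preimage_mem_nhds (e.open_baseSet.mem_nhds
      (FiberBundle.mem_baseSet_trivializationAt' (g x₀)))
  -- coordinates of the vector fields
  let c : Fin n → M → E' := fun i x => (e ⟨g x, W i x⟩).2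
  have hc : ∀ i, ContMDiffAt I 𝓘(ℝ, E') ∞ (c i) x₀ := fun i =>
    ((Bundle.contMDiffAt_totalSpace).1 (hW i)).2
  have hcj : ∀ i j, ContMDiffAt I 𝓘(ℝ, ℝ) ∞ (fun x => b.repr (c i x) j) x₀ := fun i j => by
    have : ContDiff ℝ ∞ (fun v : E' => b.repr v j) :=
      ((LinearMap.toContinuousLinearMap (b.coord j)).contDiff)
    exact this.contMDiff.contMDiffAt.comp x₀ (hc i)
  have key : (fun x => w.1 (g x) fun i => W i x) =ᶠ[nhds x₀] fun x =>
      ∑ r : Fin n → Fin (Module.finrank ℝ E'), (∏ i, b.repr (c i x) (r i)) •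
        w.1 (g x) fun i => e.symm (g x) (b (r i)) := by
    filter_upwards [hmem] with x hx
    have hWx : ∀ i, W i x = ∑ j, b.repr (c i x) j • (e.symmₗ ℝ (g x) (b j)) := by
      intro i
      have h1 : W i x = e.symmₗ ℝ (g x) (c i x) := by
        rw [e.coe_symmₗ hx]
        exact (e.symm_apply_apply_mk hx (W i x)).symm
      rw [h1]
      conv_lhs => rw [← b.sum_repr (c i x)]
      rw [map_sum]
      simp
    have h2 : (fun i => W i x) = fun i => ∑ j, b.repr (c i x) j • (e.symmₗ ℝ (g x) (b j)) :=
      funext hWx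
    rw [h2]
    have := (w.1 (g x)).toMultilinearMap.map_sum
      (fun i j => b.repr (c i x) j • (e.symmₗ ℝ (g x) (b j)))
    refine this.trans (Finset.sum_congr rfl fun r _ => ?_)
    rw [← e.coe_symmₗ (R := ℝ) hx]
    exact (w.1 (g x)).toMultilinearMap.map_smul_univ _ _
  refine ContMDiffAt.congr_of_eventuallyEq ?_ key
  refine ContMDiffAt.sum fun r _ => ?_
  have hs : ContDiff ℝ ∞ (fun p : ℝ × ℂ => p.1 • p.2) := contDiff_smul
  have h1 : ContMDiffAt I 𝓘(ℝ, ℝ) ∞ (fun x => ∏ i, b.repr (c i x) (r i)) x₀ :=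
    ContMDiffAt.prod fun i _ => hcj i (r i)
  have h2 : ContMDiffAt I 𝓘(ℝ, ℂ) ∞ (fun x => w.1 (g x) fun i => e.symm (g x) (b (r i))) x₀ := by
    have h := (w.2 (g x₀) (fun i => b (r i))).contMDiffAt
      ((chartAt H' (g x₀)).open_source.mem_nhds (mem_chart_source H' (g x₀)))
    exact h.comp x₀ hg
  exact hs.contMDiff.contMDiffAt.comp x₀ (h1.prodMk_space h2)

/-- The coordinate vector fields of a chart are smooth on the domain of the chart. -/
theorem contMDiffOn_frame (x₀ : M) (v : E) :
    ContMDiffOn I I.tangent ∞ (fun x => (⟨x, (trivializationAt E (TangentSpace I : M → Type _) x₀).symm x v⟩ :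
      TangentBundle I M)) (chartAt H x₀).source := by
  have h := (trivializationAt E (TangentSpace I : M → Type _) x₀).contMDiffOn_section_baseSet_iff
    (IB := I) (n := ∞)
    (s := fun x => (trivializationAt E (TangentSpace I : M → Type _) x₀).symm x v)
  rw [TangentBundle.trivializationAt_baseSet] at h
  rw [h]
  refine (contMDiffOn_const (c := v)).congr fun x hx => ?_
  have := (trivializationAt E (TangentSpace I : M → Type _) x₀).apply_mk_symm
    (b := x) (by rwa [TangentBundle.trivializationAt_baseSet]) v
  rw [this]

/-- Pull-back of differential forms of a fixed degree along a smooth map. -/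
def pullbackDeg [FiniteDimensional ℝ E'] (f : C^∞⟮I, M; I', M'⟯) (n : ℕ) :
    DiffForm I' M' n →ₗ[ℂ] DiffForm I M n where
  toFun w := ⟨fun x => (w.1 (f x)).compLinearMap (mfderiv I I' f x).toLinearMap, by
    intro x₀ v x hx
    refine (contMDiffAt_form_apply w (g := f) (fun i x => mfderiv I I' f x
      ((trivializationAt E (TangentSpace I : M → Type _) x₀).symm x (v i))) (fun i => ?_)
      f.contMDiff.contMDiffAt).contMDiffWithinAt
    have h1 := ((contMDiffOn_frame (I := I) x₀ (v i)).contMDiffAt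
      ((chartAt H x₀).open_source.mem_nhds hx))
    have h2 : ContMDiff I.tangent I'.tangent ∞ (tangentMap I I' f) :=
      f.contMDiff.contMDiff_tangentMap le_rfl
    exact h2.contMDiffAt.comp x h1⟩
  map_add' _ _ := rfl
  map_smul' _ _ := rfl

/-- Pull-back of differential forms along a smooth map. -/
def pullback [FiniteDimensional ℝ E'] (f : C^∞⟮I, M; I', M'⟯) : Omega I' M' →ₗ[ℂ] Omega I M :=
  liftDeg fun n => ofDeg I n ∘ₗ pullbackDeg f n

/-- Contraction of a form of degree `n + 1` with a smooth vector field in the first slot. -/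
def contractDeg [FiniteDimensional ℝ E] (V : Cₛ^∞⟮I; E, (TangentSpace I : M → Type _)⟯) (n : ℕ) :
    DiffForm I M (n + 1) →ₗ[ℂ] DiffForm I M n where
  toFun w := ⟨fun x => (w.1 x).curryLeft (V x), by
    intro x₀ v x hx
    refine (contMDiffAt_form_apply w (g := id) (fun i x => (Matrix.vecCons (V x) fun j =>
      (trivializationAt E (TangentSpace I : M → Type _) x₀).symm x (v j)) i) (fun i => ?_)
      contMDiffAt_id).contMDiffWithinAt
    refine Fin.cases ?_ (fun j => ?_) i
    · exact V.contMDiff.contMDiffAt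
    · exact ((contMDiffOn_frame (I := I) x₀ (v j)).contMDiffAt
        ((chartAt H x₀).open_source.mem_nhds hx))⟩
  map_add' _ _ := rfl
  map_smul' _ _ := rfl

/-- Contraction of differential forms with a smooth vector field. It vanishes on functions. -/
def contract [FiniteDimensional ℝ E] :
    Cₛ^∞⟮I; E, (TangentSpace I : M → Type _)⟯ →ₗ[ℝ] Module.End ℂ (Omega I M) where
  toFun V := liftDeg fun n => match n with
    | 0 => 0
    | m + 1 => ofDeg I m ∘ₗ contractDeg V m
  map_add' V W := by
    refine omega_hom_ext fun n w => ?_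
    rw [LinearMap.add_apply]
    simp only [liftDeg_ofDeg]
    rcases n with _ | m
    · simp
    · have : contractDeg (V + W) m w = contractDeg V m w + contractDeg W m w := by
        apply Subtype.ext
        funext x
        exact (w.1 x).curryLeft.map_add (V x) (W x)
      simp [this]
  map_smul' c V := by
    refine omega_hom_ext fun n w => ?_
    rw [RingHom.id_apply, LinearMap.smul_apply]
    simp only [liftDeg_ofDeg]
    rcases n with _ | m
    · simp
    · have : contractDeg (c • V) m w = (c : ℂ) • contractDeg V m w := by
        apply Subtype.ext
        funext x
        exact (w.1 x).curryLeft.map_smul c (V x)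
      simp [this]
end Forms

section LieGroup

variable {F : Type*} [NormedAddCommGroup F] [NormedSpace ℝ F] [FiniteDimensional ℝ F]
  {K : Type*} [TopologicalSpace K] (J : ModelWithCorners ℝ F K)
  (G : Type*) [TopologicalSpace G] [ChartedSpace K G] [Group G] [LieGroup J ∞ G]

instance : ENat.LEInfty (minSmoothness ℝ 3) := ⟨by
  rw [minSmoothness_of_isRCLikeNormedField]; exact ENat.LEInfty.out⟩

instance : Module.Finite ℝ (GroupLieAlgebra J G) := inferInstanceAs (Module.Finite ℝ F)

/-- The complexified Lie algebra of a real Lie group. -/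
abbrev LieC : Type _ := ℂ ⊗[ℝ] GroupLieAlgebra J G

variable {J G}

variable {E : Type*} [NormedAddCommGroup E] [NormedSpace ℝ E]
  {H : Type*} [TopologicalSpace H] {I : ModelWithCorners ℝ E H}
  {M : Type*} [TopologicalSpace M] [ChartedSpace H M] [IsManifold I ∞ M]

/-- The vector field `x ↦ d/dt A (exp (t a), x)` at `t = 0`, that is, the derivative of
`h ↦ A (h, x)` at the identity in the direction `a`, for a smooth map `A` with `A (1, x) = x`. -/
def genField (A : C^∞⟮J.prod I, G × M; I, M⟯) (hA : ∀ x, A (1, x) = x) :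
    GroupLieAlgebra J G →ₗ[ℝ] Cₛ^∞⟮I; E, (TangentSpace I : M → Type _)⟯ where
  toFun a := ⟨fun x => (mfderiv J I (fun h : G => A (h, x)) 1 a : E), by
    have h1 : ContMDiff I J.tangent ∞ (fun _ : M => (⟨1, a⟩ : TangentBundle J G)) :=
      contMDiff_const
    have h2 : ContMDiff I I.tangent ∞ (fun x : M => (⟨x, 0⟩ : TangentBundle I M)) :=
      Bundle.contMDiff_zeroSection ℝ _
    have h3 : ContMDiff (J.tangent.prod I.tangent) (J.prod I).tangent ∞
      (equivTangentBundleProd J G I M).symm := contMDiff_equivTangentBundleProd_symm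
    have h4 : ContMDiff (J.prod I).tangent I.tangent ∞ (tangentMap (J.prod I) I A) :=
      A.contMDiff.contMDiff_tangentMap le_rfl
    refine ((h4.comp h3).comp (h1.prodMk h2)).congr fun x => ?_
    have h5 : tangentMap (J.prod I) I A ((equivTangentBundleProd J G I M).symm (⟨1, a⟩, ⟨x, 0⟩)) =
        ⟨A (1, x), mfderiv J I (fun h : G => A (h, x)) 1 a⟩ := by
      simp only [tangentMap]
      congr 1
      refine (mfderiv_prod_eq_add_apply (A.contMDiff.mdifferentiableAt (by simp))).trans ?_
      have h6 : mfderiv I I (fun z : M => A (1, z)) x 0 = 0 := ContinuousLinearMap.map_zero _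
      exact (congrArg (fun z => mfderiv J I (fun h : G => A (h, x)) 1 a + z) h6).trans (add_zero _)
    refine Eq.trans ?_ h5.symm
    generalize mfderiv J I (fun h : G => A (h, x)) 1 a = v
    revert v
    rw [hA]
    intro v
    rfl⟩
  map_add' a b := by
    ext x
    exact (mfderiv J I (fun h : G => A (h, x)) 1).map_add a b
  map_smul' c a := by
    ext x
    exact (mfderiv J I (fun h : G => A (h, x)) 1).map_smul c a

section Ad

variable (J)

theorem contMDiff_conj (g : G) : ContMDiff J J ∞ (fun x : G => g * x * g⁻¹) :=
  (contMDiff_const.mul contMDiff_id).mul contMDiff_const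

/-- The derivative at the identity of the conjugation by `g`. -/
def adLin (g : G) : GroupLieAlgebra J G →L[ℝ] GroupLieAlgebra J G :=
  (mfderiv J J (fun x : G => g * x * g⁻¹) 1 : F →L[ℝ] F)

theorem mfderiv_conj_mulInvariantVectorField (g : G) (v : GroupLieAlgebra J G) (h : G) :
    mfderiv J J (fun x : G => g * x * g⁻¹) h (mulInvariantVectorField v h) =
      mulInvariantVectorField (adLin J g v) (g * h * g⁻¹) := by
  have hl : ∀ k : G, MDifferentiable J J (fun x : G => k * x) := fun k =>
    (contMDiff_mul_left (I := J) (n := ∞) (a := k)).mdifferentiable (by simp)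
  have hc : MDifferentiable J J (fun x : G => g * x * g⁻¹) :=
    (contMDiff_conj J g).mdifferentiable (by simp)
  have e1 : mfderiv J J (fun x : G => g * (h * x) * g⁻¹) 1 =
      (mfderiv J J (fun x : G => g * x * g⁻¹) (h * 1)).comp (mfderiv J J (fun x : G => h * x) 1) :=
    mfderiv_comp (I' := J) (1 : G) (hc (h * 1)) (hl h 1)
  have e2 : mfderiv J J (fun x : G => (g * h * g⁻¹) * (g * x * g⁻¹)) 1 =
      (mfderiv J J (fun x : G => (g * h * g⁻¹) * x) (g * 1 * g⁻¹)).comp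
        (mfderiv J J (fun x : G => g * x * g⁻¹) 1) :=
    mfderiv_comp (I' := J) (1 : G) (hl _ _) (hc 1)
  have e3 : (fun x : G => (g * h * g⁻¹) * (g * x * g⁻¹)) = fun x : G => g * (h * x) * g⁻¹ := by
    funext x; group
  have e4 : (mfderiv J J (fun x : G => (g * h * g⁻¹) * x) (g * 1 * g⁻¹) : F →L[ℝ] F) =
      (mfderiv J J (fun x : G => (g * h * g⁻¹) * x) 1 : F →L[ℝ] F) := by
    have : g * 1 * g⁻¹ = 1 := by group
    rw [this]
  have e5 : (mfderiv J J (fun x : G => g * x * g⁻¹) (h * 1) : F →L[ℝ] F) =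
      (mfderiv J J (fun x : G => g * x * g⁻¹) h : F →L[ℝ] F) := by
    rw [mul_one]
  have a1 := DFunLike.congr_fun (show (_ : F →L[ℝ] F) = _ from e1) v
  have a2 := DFunLike.congr_fun (show (_ : F →L[ℝ] F) = _ from e2) v
  have a3 : (mfderiv J J (fun x : G => (g * h * g⁻¹) * (g * x * g⁻¹)) 1 : F →L[ℝ] F) =
    (mfderiv J J (fun x : G => g * (h * x) * g⁻¹) 1 : F →L[ℝ] F) := by rw [e3]
  have a3' := DFunLike.congr_fun a3 v
  have a4 := DFunLike.congr_fun e4 (mfderiv J J (fun x : G => g * x * g⁻¹) 1 v)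
  have a5 := DFunLike.congr_fun e5 (mfderiv J J (fun x : G => h * x) 1 v)
  exact (a5.symm.trans (a1.symm.trans a3'.symm)).trans (a2.trans a4)

theorem isInvertible_mfderiv_conj (g h : G) :
    (mfderiv J J (fun x : G => g * x * g⁻¹) h).IsInvertible := by
  let e : G ≃ₘ^∞⟮J, J⟯ G :=
    { toFun := fun x => g * x * g⁻¹
      invFun := fun x => g⁻¹ * x * g
      left_inv := fun x => by group
      right_inv := fun x => by group
      contMDiff_toFun := contMDiff_conj J g
      contMDiff_invFun := by simpa using contMDiff_conj J g⁻¹ }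
  exact ⟨e.mfderivToContinuousLinearEquiv (by simp) h, rfl⟩

theorem mpullback_conj (g : G) (v : GroupLieAlgebra J G) :
    VectorField.mpullback J J (fun x : G => g * x * g⁻¹) (mulInvariantVectorField (adLin J g v)) =
      mulInvariantVectorField v := by
  funext h
  rw [VectorField.mpullback_apply, ← mfderiv_conj_mulInvariantVectorField]
  exact (isInvertible_mfderiv_conj J g h).inverse_apply_self _

/-- The adjoint action of `g`, an endomorphism of the Lie algebra. -/
def Ad (g : G) : GroupLieAlgebra J G →ₗ⁅ℝ⁆ GroupLieAlgebra J G where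
  toLinearMap := (adLin J g).toLinearMap
  map_lie' := by
    intro v w
    have hn : minSmoothness ℝ 2 ≤ (∞ : WithTop ℕ∞) := by
      rw [minSmoothness_of_isRCLikeNormedField]; exact ENat.LEInfty.out
    have key := VectorField.mpullback_mlieBracket (I := J) (I' := J) (n := ∞)
      (f := fun x : G => g * x * g⁻¹) (x₀ := 1)
      (V := mulInvariantVectorField (adLin J g v)) (W := mulInvariantVectorField (adLin J g w))
      (mdifferentiableAt_mulInvariantVectorField _) (mdifferentiableAt_mulInvariantVectorField _)
      (contMDiff_conj J g).contMDiffAt hn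
    rw [mpullback_conj, mpullback_conj] at key
    have hb : mfderiv J J (fun x : G => g * x * g⁻¹) 1 (VectorField.mpullback J J
        (fun x : G => g * x * g⁻¹) (VectorField.mlieBracket J
          (mulInvariantVectorField (adLin J g v)) (mulInvariantVectorField (adLin J g w))) 1) =
        VectorField.mlieBracket J (mulInvariantVectorField (adLin J g v))
          (mulInvariantVectorField (adLin J g w)) (g * 1 * g⁻¹) := by
      rw [VectorField.mpullback_apply]
      exact (isInvertible_mfderiv_conj J g 1).self_apply_inverse _
    rw [key] at hb
    have h1 : g * 1 * g⁻¹ = 1 := by group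
    have h2 : (VectorField.mlieBracket J (mulInvariantVectorField (adLin J g v))
          (mulInvariantVectorField (adLin J g w)) (g * 1 * g⁻¹) : F) =
        (VectorField.mlieBracket J (mulInvariantVectorField (adLin J g v))
          (mulInvariantVectorField (adLin J g w)) (1 : G) : F) := by
      rw [h1]
    exact Eq.trans (α := F) hb h2

/-- The adjoint action of `g` on the complexified Lie algebra. -/
def AdC (g : G) : LieC J G →ₗ⁅ℂ⁆ LieC J G where
  toLinearMap := (Ad J g).toLinearMap.baseChange ℂ
  map_lie' := by
    intro x y
    change (Ad J g).toLinearMap.baseChange ℂ ⁅x, y⁆ =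
      ⁅(Ad J g).toLinearMap.baseChange ℂ x, (Ad J g).toLinearMap.baseChange ℂ y⁆
    have z1 : ∀ v : LieC J G, ⁅(0 : LieC J G), v⁆ = 0 := zero_lie
    have z2 : ∀ v : LieC J G, ⁅v, (0 : LieC J G)⁆ = 0 :=
      lie_zero (L := LieC J G) (M := LieC J G)
    have a1 : ∀ u v w : LieC J G, ⁅u + v, w⁆ = ⁅u, w⁆ + ⁅v, w⁆ := add_lie
    have a2 : ∀ u v w : LieC J G, ⁅u, v + w⁆ = ⁅u, v⁆ + ⁅u, w⁆ :=
      lie_add (L := LieC J G) (M := LieC J G)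
    have t : ∀ (s t : ℂ) (a b : GroupLieAlgebra J G),
        ⁅(s ⊗ₜ[ℝ] a : LieC J G), (t ⊗ₜ[ℝ] b : LieC J G)⁆ = (s * t) ⊗ₜ[ℝ] ⁅a, b⁆ :=
      LieAlgebra.ExtendScalars.bracket_tmul ℝ ℂ (GroupLieAlgebra J G) (GroupLieAlgebra J G)
    induction x using TensorProduct.induction_on with
    | zero => rw [z1, map_zero, z1]
    | add x x' hx hx' => rw [a1, map_add, map_add, a1, hx, hx']
    | tmul s a =>
      induction y using TensorProduct.induction_on with
      | zero => rw [z2, map_zero, z2]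
      | add y y' hy hy' => rw [a2, map_add, map_add, a2, hy, hy']
      | tmul u b =>
        rw [t, LinearMap.baseChange_tmul, LinearMap.baseChange_tmul, LinearMap.baseChange_tmul, t]
        exact congrArg (fun z => (s * u) ⊗ₜ[ℝ] z) ((Ad J g).map_lie a b)

end Ad

variable (J G)

/-- A nondegenerate symmetric complex bilinear form on the complexified Lie algebra that is
invariant under the adjoint action of the group. -/
structure InvForm where
  /-- the bilinear form -/
  form : LinearMap.BilinForm ℂ (LieC J G)
  symm : form.IsSymm
  nondeg : form.Nondegenerate
  inv : ∀ (g : G) (a b : LieC J G), form (AdC J g a) (AdC J g b) = form a b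

/-- The enveloping algebra of the complexified Lie algebra. -/
abbrev EnvAlg : Type _ := UniversalEnvelopingAlgebra ℂ (LieC J G)

/-- The adjoint action of `g` on the enveloping algebra. -/
def AdU {G : Type*} [TopologicalSpace G] [ChartedSpace K G] [Group G] [LieGroup J ∞ G] (g : G) :
    EnvAlg J G →ₐ[ℂ] EnvAlg J G :=
  letI : LieRing (EnvAlg J G) := LieRing.ofAssociativeRing
  UniversalEnvelopingAlgebra.lift ℂ ((UniversalEnvelopingAlgebra.ι ℂ).comp (AdC J g))

variable {J G}

namespace InvForm

variable (B : InvForm J G)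

/-- The quadratic form `x ↦ ⟨x, x⟩ / 2`. -/
def quad : QuadraticForm ℂ (LieC J G) := (2⁻¹ : ℂ) • B.form.toQuadraticMap

/-- The Clifford algebra, with relations `2 x x = ⟨x, x⟩`. -/
abbrev Cl : Type _ := CliffordAlgebra B.quad

/-- The symbol map from the Clifford algebra to the exterior algebra. -/
def symbol : B.Cl ≃ₗ[ℂ] ExteriorAlgebra ℂ (LieC J G) := CliffordAlgebra.equivExterior B.quad

/-- The adjoint action of `g` on the Clifford algebra. -/
def AdCl (g : G) : B.Cl →ₐ[ℂ] B.Cl :=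
  CliffordAlgebra.map
    { toLinearMap := (AdC J g).toLinearMap
      map_app' := fun a => congrArg (fun z : ℂ => (2⁻¹ : ℂ) • z) (B.inv g a a) }

/-- The contraction with `a` on the exterior algebra: the super-derivation with `b ↦ ⟨a, b⟩`. -/
def contrExt (a : LieC J G) :
    ExteriorAlgebra ℂ (LieC J G) →ₗ[ℂ] ExteriorAlgebra ℂ (LieC J G) :=
  CliffordAlgebra.contractLeft (Q := (0 : QuadraticForm ℂ (LieC J G))) (B.form a)

/-- The contraction with `a` on the Clifford algebra, by the identification with the exterior
algebra as a vector space. -/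
def contrCl (a : LieC J G) : B.Cl →ₗ[ℂ] B.Cl :=
  B.symbol.symm.toLinearMap ∘ₗ B.contrExt a ∘ₗ B.symbol.toLinearMap

/-- The non-commutative Weil algebra `U(𝔤) ⊗ Cl(𝔤)`. -/
abbrev Weil : Type _ := EnvAlg J G ⊗[ℂ] B.Cl

/-- The parity operator of the Weil algebra: `1` on even and `-1` on odd elements. -/
def parity : B.Weil →ₗ[ℂ] B.Weil :=
  (CliffordAlgebra.involute (Q := B.quad)).toLinearMap.lTensor (EnvAlg J G)

/-- The contraction with `a` on the Weil algebra. -/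
def contrWeil (a : LieC J G) : B.Weil →ₗ[ℂ] B.Weil := (B.contrCl a).lTensor (EnvAlg J G)

/-- The adjoint action of `g` on the Weil algebra. -/
def AdWeil (g : G) : B.Weil →ₗ[ℂ] B.Weil :=
  TensorProduct.map (AdU J g).toLinearMap (B.AdCl g).toLinearMap

/-- The augmentation `Cl(𝔤) ≃ Λ(𝔤) → ℂ`, the projection to degree zero. -/
def augCl : B.Cl →ₗ[ℂ] ℂ :=
  (ExteriorAlgebra.algebraMapInv (R := ℂ) (M := LieC J G)).toLinearMap ∘ₗ B.symbol.toLinearMap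

/-- The projection `U(𝔤) ⊗ Cl(𝔤) → U(𝔤)` induced by the augmentation. -/
def augWeil : B.Weil →ₗ[ℂ] EnvAlg J G :=
  (TensorProduct.rid ℂ (EnvAlg J G)).toLinearMap ∘ₗ B.augCl.lTensor (EnvAlg J G)

/-- The isomorphism `Λ(𝔤*) → Λ(𝔤)` induced by the bilinear form. -/
def extDual : ExteriorAlgebra ℂ (Module.Dual ℂ (LieC J G)) →ₐ[ℂ] ExteriorAlgebra ℂ (LieC J G) :=
  ExteriorAlgebra.map (B.form.toDual B.nondeg).symm.toLinearMap

end InvForm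

section Action

variable (M) [FiniteDimensional ℝ E] [MulAction G M] [ContMDiffSMul J I ∞ G M]

variable (J I) in
/-- The diffeomorphism of `M` given by `g`. -/
def actMap (g : G) : C^∞⟮I, M; I, M⟯ :=
  ⟨fun x => g • x, (contMDiff_smul (I := J) (I' := I) (n := ∞) (G := G) (M := M)).comp
    (contMDiff_const.prodMk contMDiff_id)⟩

variable (J I) in
/-- The action of `g` on the differential forms of `M`, by pull-back along `g⁻¹`. -/
def actForm (g : G) : Omega I M →ₗ[ℂ] Omega I M := pullback (actMap J I M g⁻¹)

variable (J I G) in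
/-- The map `(h, x) ↦ h⁻¹ • x`. -/
def invAct : C^∞⟮J.prod I, G × M; I, M⟯ :=
  ⟨fun p => p.1⁻¹ • p.2, (contMDiff_smul (I := J) (I' := I) (n := ∞) (G := G) (M := M)).comp
    (contMDiff_fst.inv.prodMk contMDiff_snd)⟩

variable (J I G) in
/-- The contraction operators on forms: the contraction with `a` in the Lie algebra is the
contraction with the vector field `x ↦ d/dt exp (- t a) x`, and it is complex linear in `a`.
The sign is the one for which the Lie derivative, which is the super-commutator of the
contraction and the de Rham differential, is the derivative of the action on forms. -/
def contrForm : LieC J G →ₗ[ℂ] Module.End ℂ (Omega I M) :=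
  LinearMap.liftBaseChange ℂ
    (contract ∘ₗ genField (invAct J G I M) (fun x => by simp [invAct]))

end Action

end LieGroup

section Assoc

variable {F : Type*} [NormedAddCommGroup F] [NormedSpace ℝ F]
  {K : Type*} [TopologicalSpace K] (J : ModelWithCorners ℝ F K)
  {E : Type*} [NormedAddCommGroup E] [NormedSpace ℝ E]
  {H : Type*} [TopologicalSpace H] (I : ModelWithCorners ℝ E H)
  (G : Type*) [TopologicalSpace G] [ChartedSpace K G] [Group G] [LieGroup J ∞ G]
  (M : Type*) [TopologicalSpace M] [ChartedSpace H M] [IsManifold I ∞ M]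
  [MulAction G M] [ContMDiffSMul J I ∞ G M]

/-- The equivalence relation on `G × M` given by `(g, m) ∼ (g k⁻¹, k • m)`. -/
def assocSetoid : Setoid (G × M) where
  r p q := ∃ k : G, q = (p.1 * k⁻¹, k • p.2)
  iseqv :=
    { refl := fun p => ⟨1, by simp⟩
      symm := by
        rintro p q ⟨k, rfl⟩
        exact ⟨k⁻¹, by simp⟩
      trans := by
        rintro p q r ⟨k, rfl⟩ ⟨l, rfl⟩
        exact ⟨l * k, by simp [mul_assoc, mul_smul]⟩ }

/-- The fibre product of `G` and `M` over `G`, the quotient of `G × M` by the action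
`k (g, m) = (g k⁻¹, k • m)`. The models `J` and `I` only serve to find the manifold structure. -/
def AssocSpace (_ : ModelWithCorners ℝ F K) (_ : ModelWithCorners ℝ E H) (G M : Type*) [Group G]
    [MulAction G M] : Type _ :=
  Quotient (assocSetoid G M)

namespace AssocSpace

/-- The class of `(g, m)`. -/
def mk (p : G × M) : AssocSpace J I G M := Quotient.mk (assocSetoid G M) p

instance : TopologicalSpace (AssocSpace J I G M) :=
  inferInstanceAs (TopologicalSpace (Quotient (assocSetoid G M)))

/-- The map `[g, m] ↦ g • m`. -/
def act : AssocSpace J I G M → M :=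
  Quotient.lift (fun p : G × M => p.1 • p.2) (by
    rintro p q ⟨k, rfl⟩
    simp [mul_smul])

variable {J I G M}

theorem act_mk (p : G × M) : act J I G M (mk J I G M p) = p.1 • p.2 := rfl

theorem mk_eq (g : G) (m : M) : mk J I G M (1, g • m) = mk J I G M (g, m) :=
  Quotient.sound (s := assocSetoid G M) ⟨g⁻¹, by simp⟩

theorem mk_act (x : AssocSpace J I G M) : mk J I G M (1, act J I G M x) = x := by
  induction x using Quotient.inductionOn with
  | h p => exact mk_eq p.1 p.2

variable (J I G M)

/-- The action map is a homeomorphism, with inverse `m ↦ [1, m]`. -/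
def homeo : AssocSpace J I G M ≃ₜ M where
  toFun := act J I G M
  invFun m := mk J I G M (1, m)
  left_inv := mk_act
  right_inv m := by simp [act_mk]
  continuous_toFun := Continuous.quotient_lift
    (contMDiff_smul (I := J) (I' := I) (n := ∞) (G := G) (M := M)).continuous _
  continuous_invFun := continuous_quotient_mk'.comp (by fun_prop)

/-- The charts of the fibre product. The resulting manifold structure is the quotient structure,
by `contMDiff_iff_comp_proj` and `mfderiv_proj_surjective` below. -/
instance : ChartedSpace H (AssocSpace J I G M) where
  atlas := (fun c => (homeo J I G M).toOpenPartialHomeomorph.trans c) '' atlas H M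
  chartAt x := (homeo J I G M).toOpenPartialHomeomorph.trans (chartAt H (act J I G M x))
  mem_chart_source x := by
    simp only [OpenPartialHomeomorph.trans_source, Homeomorph.toOpenPartialHomeomorph_source]
    exact ⟨trivial, mem_chart_source H (act J I G M x)⟩
  chart_mem_atlas x := ⟨_, chart_mem_atlas H _, rfl⟩

instance : IsManifold I ∞ (AssocSpace J I G M) where
  compatible := by
    rintro _ _ ⟨c, hc, rfl⟩ ⟨c', hc', rfl⟩
    have h : ((homeo J I G M).toOpenPartialHomeomorph.trans c).symm.trans
        ((homeo J I G M).toOpenPartialHomeomorph.trans c') = c.symm.trans c' := by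
      rw [OpenPartialHomeomorph.trans_symm_eq_symm_trans_symm, OpenPartialHomeomorph.trans_assoc,
        ← OpenPartialHomeomorph.trans_assoc _ _ c', ← Homeomorph.symm_toOpenPartialHomeomorph,
        ← Homeomorph.trans_toOpenPartialHomeomorph, Homeomorph.symm_trans_self,
        Homeomorph.refl_toOpenPartialHomeomorph, OpenPartialHomeomorph.refl_trans]
    rw [h]
    exact HasGroupoid.compatible hc hc'

theorem contMDiff_act : ContMDiff I I ∞ (act J I G M) := by
  intro x
  have h1 : ContMDiffAt I I ∞ (chartAt H x) x :=
    contMDiffOn_chart.contMDiffAt ((chartAt H x).open_source.mem_nhds (mem_chart_source H x))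
  have h2 : ContMDiffAt I I ∞ (chartAt H (act J I G M x)).symm (chartAt H x x) :=
    contMDiffOn_chart_symm.contMDiffAt ((chartAt H (act J I G M x)).open_target.mem_nhds
      (mem_chart_target H (act J I G M x)))
  refine (h2.comp x h1).congr_of_eventuallyEq ?_
  filter_upwards [(chartAt H x).open_source.mem_nhds (mem_chart_source H x)] with y hy
  exact ((chartAt H (act J I G M x)).left_inv hy.2).symm

theorem contMDiff_mk_one : ContMDiff I I ∞ (fun m : M => mk J I G M (1, m)) := by
  intro m
  have hm : act J I G M (mk J I G M (1, m)) = m := by simp [act_mk]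
  have h1 : ContMDiffAt I I ∞ (chartAt H m) m :=
    contMDiffOn_chart.contMDiffAt ((chartAt H m).open_source.mem_nhds (mem_chart_source H m))
  have hc : chartAt H (mk J I G M (1, m)) =
      (homeo J I G M).toOpenPartialHomeomorph.trans (chartAt H m) :=
    congrArg (fun z => (homeo J I G M).toOpenPartialHomeomorph.trans (chartAt H z)) hm
  have hp : chartAt H m m = chartAt H (mk J I G M (1, m)) (mk J I G M (1, m)) := by
    rw [hc]
    exact congrArg (chartAt H m) hm.symm
  have h2 : ContMDiffAt I I ∞ (chartAt H (mk J I G M (1, m))).symm (chartAt H m m) := by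
    rw [hp]
    exact contMDiffOn_chart_symm.contMDiffAt ((chartAt H (mk J I G M (1, m))).open_target.mem_nhds
      (mem_chart_target H (mk J I G M (1, m))))
  refine (h2.comp m h1).congr_of_eventuallyEq ?_
  filter_upwards [(chartAt H m).open_source.mem_nhds (mem_chart_source H m)] with y hy
  rw [hc]
  exact congrArg (fun z => mk J I G M (1, z)) ((chartAt H m).left_inv hy).symm

/-- The projection `G × M → G ×^G M`. -/
def proj : C^∞⟮J.prod I, G × M; I, AssocSpace J I G M⟯ :=
  ⟨mk J I G M, ((contMDiff_mk_one J I G M).comp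
    (contMDiff_smul (I := J) (I' := I) (n := ∞) (G := G) (M := M))).congr
      fun p => (mk_eq p.1 p.2).symm⟩

/-- The map `μ : G ×^G M → M`, `[g, m] ↦ g • m`. -/
def mu : C^∞⟮I, AssocSpace J I G M; I, M⟯ := ⟨act J I G M, contMDiff_act J I G M⟩

/-- The manifold structure is the quotient structure: a map out of the fibre product is smooth if
and only if its composite with the projection is. -/
theorem contMDiff_iff_comp_proj {E' : Type*} [NormedAddCommGroup E'] [NormedSpace ℝ E']
    {H' : Type*} [TopologicalSpace H'] {I' : ModelWithCorners ℝ E' H'}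
    {N : Type*} [TopologicalSpace N] [ChartedSpace H' N] (f : AssocSpace J I G M → N) :
    ContMDiff I I' ∞ f ↔ ContMDiff (J.prod I) I' ∞ (f ∘ proj J I G M) := by
  refine ⟨fun h => h.comp (proj J I G M).contMDiff, fun h => ?_⟩
  refine ((h.comp ((contMDiff_const (c := (1 : G))).prodMk contMDiff_id)).comp
    (contMDiff_act J I G M)).congr fun x => ?_
  exact congrArg f (mk_act x).symm

/-- The projection is a submersion. -/
theorem mfderiv_proj_surjective (p : G × M) :
    Function.Surjective (mfderiv (J.prod I) I (proj J I G M) p) := by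
  have hs : ContMDiff I (J.prod I) ∞
      (fun x : AssocSpace J I G M => (p.1, p.1⁻¹ • act J I G M x)) :=
    contMDiff_const.prodMk ((contMDiff_smul (I := J) (I' := I) (n := ∞) (G := G) (M := M)).comp
      (contMDiff_const.prodMk (contMDiff_act J I G M)))
  have hid : proj J I G M ∘ (fun x : AssocSpace J I G M => (p.1, p.1⁻¹ • act J I G M x)) = id := by
    funext x
    refine (mk_eq (J := J) (I := I) p.1 (p.1⁻¹ • act J I G M x)).symm.trans ?_
    rw [smul_inv_smul]
    exact mk_act x
  have hp : (fun x : AssocSpace J I G M => (p.1, p.1⁻¹ • act J I G M x)) (mk J I G M p) = p := by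
    simp [act_mk]
  have h := mfderiv_comp (I := I) (I' := J.prod I) (I'' := I) (mk J I G M p)
    ((proj J I G M).contMDiff.mdifferentiable (by simp) _) (hs.mdifferentiable (by simp) _)
  rw [hid, mfderiv_id] at h
  intro v
  refine ⟨(mfderiv I (J.prod I) (fun x : AssocSpace J I G M => (p.1, p.1⁻¹ • act J I G M x))
    (mk J I G M p) v : F × E), ?_⟩
  have h2 := DFunLike.congr_fun (show (_ : E →L[ℝ] E) = _ from h) v
  have h3 : ∀ q : G × M, q = p → (mfderiv (J.prod I) I (proj J I G M) q : F × E →L[ℝ] E) =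
    (mfderiv (J.prod I) I (proj J I G M) p : F × E →L[ℝ] E) := by rintro q rfl; rfl
  have h4 := DFunLike.congr_fun (h3 (p.1, p.1⁻¹ • act J I G M (mk J I G M p)) hp) (mfderiv I (J.prod I)
    (fun x : AssocSpace J I G M => (p.1, p.1⁻¹ • act J I G M x)) (mk J I G M p) v : F × E)
  exact h4.symm.trans h2.symm

/-- The action of `G` by left multiplication on the first factor. -/
instance : MulAction G (AssocSpace J I G M) where
  smul h := Quotient.map (fun p : G × M => (h * p.1, p.2)) (by
    rintro p q ⟨k, rfl⟩
    exact ⟨k, by simp [mul_assoc]⟩)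
  one_smul x := by
    induction x using Quotient.inductionOn with
    | h p => exact congrArg (mk J I G M) (Prod.ext (one_mul p.1) rfl)
  mul_smul g h x := by
    induction x using Quotient.inductionOn with
    | h p => exact congrArg (mk J I G M) (Prod.ext (mul_assoc g h p.1) rfl)

theorem smul_mk (h : G) (p : G × M) : h • mk J I G M p = mk J I G M (h * p.1, p.2) := rfl

/-- The map `μ` is equivariant. -/
theorem mu_smul (h : G) (x : AssocSpace J I G M) : mu J I G M (h • x) = h • mu J I G M x := by
  induction x using Quotient.inductionOn with
  | h p => exact mul_smul h p.1 p.2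

instance : ContMDiffSMul J I ∞ G (AssocSpace J I G M) where
  contMDiff_smul := by
    have h : ContMDiff (J.prod I) I ∞
        (fun p : G × AssocSpace J I G M => p.1 • act J I G M p.2) :=
      (contMDiff_smul (I := J) (I' := I) (n := ∞) (G := G) (M := M)).comp
        (contMDiff_fst.prodMk ((contMDiff_act J I G M).comp contMDiff_snd))
    refine ((contMDiff_mk_one J I G M).comp h).congr fun p => ?_
    refine (mk_act (p.1 • p.2)).symm.trans (congrArg (fun z => mk J I G M (1, z)) ?_)
    exact mu_smul J I G M p.1 p.2

end AssocSpace
end Assoc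

section Maps

variable {F : Type*} [NormedAddCommGroup F] [NormedSpace ℝ F] [FiniteDimensional ℝ F]
  {K : Type*} [TopologicalSpace K] {J : ModelWithCorners ℝ F K}
  {E : Type*} [NormedAddCommGroup E] [NormedSpace ℝ E] [FiniteDimensional ℝ E]
  {H : Type*} [TopologicalSpace H] {I : ModelWithCorners ℝ E H}
  {G : Type*} [TopologicalSpace G] [ChartedSpace K G] [Group G] [LieGroup J ∞ G]

section Evaluation

variable (J I G) (M : Type*) [TopologicalSpace M] [ChartedSpace H M] [IsManifold I ∞ M]

/-- The map `(h, (g, m)) ↦ (g h, m)`. Its generating vector fields are the left invariant vector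
fields on the factor `G` of `G × M`. -/
def rightMul : C^∞⟮J.prod (J.prod I), G × (G × M); J.prod I, G × M⟯ :=
  ⟨fun q => (q.2.1 * q.1, q.2.2),
    ((contMDiff_fst.comp contMDiff_snd).mul contMDiff_fst).prodMk
      (contMDiff_snd.comp contMDiff_snd)⟩

/-- The contraction of forms on `G × M` with the left invariant vector field on `G` defined by an
element of the Lie algebra. -/
def contrLeft : LieC J G →ₗ[ℂ] Module.End ℂ (Omega (J.prod I) (G × M)) :=
  LinearMap.liftBaseChange ℂ
    (contract ∘ₗ genField (rightMul J I G M) (fun x => by simp [rightMul]))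

/-- The inclusion of `M = 1 × M` in `G × M`. -/
def sliceOne : C^∞⟮I, M; J.prod I, G × M⟯ :=
  ⟨fun m => (1, m), contMDiff_const.prodMk contMDiff_id⟩

/-- The evaluation `w ↦ w(1)` along `1 × M` of a form on `G × M`. At the points of `1 × M` a form
on `G × M` has values in `Λ(T₁*G) ⊗ Λ(T*M)`, so that `w(1)` is an element of `Λ(𝔤*) ⊗ Ω(M)`. In
terms of a basis `e₁, …, e_d` of the Lie algebra (on which it does not depend) and of the dual basis
`f₁, …, f_d`,
`w(1) = ∑ f_{s₁} ∧ ⋯ ∧ f_{sₚ} ⊗ w_S`, the sum over the subsets `S = {s₁ < ⋯ < sₚ}` of `{1, …, d}`,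
where `w_S` is the restriction to `1 × M` of the form `w (e_{s₁}, …, e_{sₚ}, …)` whose first `p`
arguments are left invariant vector fields on `G`. -/
def evalOne : Omega (J.prod I) (G × M) →ₗ[ℂ]
    ExteriorAlgebra ℂ (Module.Dual ℂ (LieC J G)) ⊗[ℂ] Omega I M :=
  let e := Module.finBasis ℂ (LieC J G)
  ∑ S : Finset (Fin (Module.finrank ℂ (LieC J G))),
    TensorProduct.mk ℂ _ _
        (((S.sort (· ≤ ·)).map fun i => ExteriorAlgebra.ι ℂ (e.coord i)).prod) ∘ₗ
      pullback (sliceOne J I G M) ∘ₗ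
        ((S.sort (· ≤ ·)).reverse.map fun i => contrLeft J I G M (e i)).prod

end Evaluation

variable (B : InvForm J G) (M : Type*) [TopologicalSpace M] [ChartedSpace H M] [IsManifold I ∞ M]
  [MulAction G M] [ContMDiffSMul J I ∞ G M]

namespace InvForm

variable (I)

/-- The contraction with `a` on the tensor product `𝒲(𝔤) ⊗ Ω(M)` of super-spaces. -/
def contrTot (a : LieC J G) : Module.End ℂ (B.Weil ⊗[ℂ] Omega I M) :=
  (B.contrWeil a).rTensor (Omega I M) + TensorProduct.map B.parity (contrForm J G I M a)

/-- The subspace of basic elements of `𝒲(𝔤) ⊗ Ω(M)`: the `G`-invariant elements that are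
annihilated by all contractions. -/
def basic : Submodule ℂ (B.Weil ⊗[ℂ] Omega I M) where
  carrier := {z | (∀ a : LieC J G, B.contrTot I M a z = 0) ∧
    ∀ g : G, TensorProduct.map (B.AdWeil g) (actForm J I M g) z = z}
  add_mem' := fun hx hy => ⟨fun a => by rw [map_add, hx.1, hy.1, add_zero],
    fun g => by rw [map_add, hx.2, hy.2]⟩
  zero_mem' := ⟨fun _ => map_zero _, fun _ => map_zero _⟩
  smul_mem' := fun c _ hx => ⟨fun a => by rw [map_smul, hx.1, smul_zero],
    fun g => by rw [map_smul, hx.2]⟩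

/-- The map `Θ : 𝒲(𝔤) ⊗ Ω(M) → U(𝔤) ⊗ Ω(M)` induced by the augmentation. -/
def Theta : B.Weil ⊗[ℂ] Omega I M →ₗ[ℂ] EnvAlg J G ⊗[ℂ] Omega I M :=
  B.augWeil.rTensor (Omega I M)

/-- The map `ω ↦ ω(1)` for forms on `M_G = G ×^G M`, which are identified with their pull-backs to
`G × M`, with values in `Cl(𝔤) ⊗ Ω(M)` by the isomorphisms `Λ(𝔤*) ≃ Λ(𝔤) ≃ Cl(𝔤)`. -/
def evalAssoc : Omega I (AssocSpace J I G M) →ₗ[ℂ] B.Cl ⊗[ℂ] Omega I M :=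
  (B.symbol.symm.toLinearMap ∘ₗ B.extDual.toLinearMap).rTensor (Omega I M) ∘ₗ
    evalOne J I G M ∘ₗ pullback (AssocSpace.proj J I G M)

/-- The map `ψ : U(𝔤) ⊗ Ω(M_G) → 𝒲(𝔤) ⊗ Ω(M)`, `x ⊗ ω ↦ x ⊗ ω(1)`. -/
def psi : EnvAlg J G ⊗[ℂ] Omega I (AssocSpace J I G M) →ₗ[ℂ] B.Weil ⊗[ℂ] Omega I M :=
  (TensorProduct.assoc ℂ (EnvAlg J G) B.Cl (Omega I M)).symm.toLinearMap ∘ₗ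
    (B.evalAssoc I M).lTensor (EnvAlg J G)

end InvForm

variable (J I G)

/-- The `G`-invariant elements of `U(𝔤) ⊗ Ω(M)`. -/
def invariants : Submodule ℂ (EnvAlg J G ⊗[ℂ] Omega I M) where
  carrier := {z | ∀ g : G, TensorProduct.map (AdU J g).toLinearMap (actForm J I M g) z = z}
  add_mem' := fun hx hy g => by rw [map_add, hx, hy]
  zero_mem' := fun _ => map_zero _
  smul_mem' := fun c _ hx g => by rw [map_smul, hx]

/-- The map `μ* : Ω(M) → Ω(M_G)`. -/
def muPull : Omega I M →ₗ[ℂ] Omega I (AssocSpace J I G M) := pullback (AssocSpace.mu J I G M)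

/-- The map `I ⊗ μ* : U(𝔤) ⊗ Ω(M) → U(𝔤) ⊗ Ω(M_G)`. -/
def muStar : EnvAlg J G ⊗[ℂ] Omega I M →ₗ[ℂ] EnvAlg J G ⊗[ℂ] Omega I (AssocSpace J I G M) :=
  (muPull J I G M).lTensor (EnvAlg J G)

end Maps

end EquivCoh

end

open EquivCoh

namespace EquivCoh

section FormCalculus

variable {E : Type*} [NormedAddCommGroup E] [NormedSpace ℝ E]
  {H : Type*} [TopologicalSpace H] {I : ModelWithCorners ℝ E H}
  {M : Type*} [TopologicalSpace M] [ChartedSpace H M] [IsManifold I ∞ M]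
  {E' : Type*} [NormedAddCommGroup E'] [NormedSpace ℝ E'] [FiniteDimensional ℝ E']
  {H' : Type*} [TopologicalSpace H'] {I' : ModelWithCorners ℝ E' H'}
  {M' : Type*} [TopologicalSpace M'] [ChartedSpace H' M'] [IsManifold I' ∞ M']
  {E'' : Type*} [NormedAddCommGroup E''] [NormedSpace ℝ E''] [FiniteDimensional ℝ E'']
  {H'' : Type*} [TopologicalSpace H''] {I'' : ModelWithCorners ℝ E'' H''}
  {M'' : Type*} [TopologicalSpace M''] [ChartedSpace H'' M''] [IsManifold I'' ∞ M'']

theorem pullback_ofDeg (f : C^∞⟮I, M; I', M'⟯) (n : ℕ) (w : DiffForm I' M' n) :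
    pullback f (ofDeg I' n w) = ofDeg I n (pullbackDeg f n w) :=
  liftDeg_ofDeg _ n w

theorem pullback_comp (g : C^∞⟮I', M'; I'', M''⟯) (f : C^∞⟮I, M; I', M'⟯) :
    pullback (g.comp f) = pullback f ∘ₗ pullback g := by
  refine omega_hom_ext fun n w => ?_
  rw [LinearMap.comp_apply, pullback_ofDeg, pullback_ofDeg, pullback_ofDeg]
  congr 1
  apply Subtype.ext
  funext x
  have h : mfderiv I I'' (g.comp f) x = (mfderiv I' I'' g (f x)).comp (mfderiv I I' f x) :=
    mfderiv_comp x (g.contMDiff.mdifferentiable (by simp) _)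
      (f.contMDiff.mdifferentiable (by simp) _)
  ext v
  change w.1 (g (f x)) (fun i => mfderiv I I'' (g.comp f) x (v i)) =
    w.1 (g (f x)) (fun i => mfderiv I' I'' g (f x) (mfderiv I I' f x (v i)))
  rw [h]
  rfl

theorem pullback_id (f : C^∞⟮I', M'; I', M'⟯) (hf : ∀ x, f x = x) :
    pullback f = LinearMap.id := by
  obtain rfl : f = ContMDiffMap.id := by ext x; exact hf x
  refine omega_hom_ext fun n w => ?_
  rw [pullback_ofDeg, LinearMap.id_apply]
  congr 1
  apply Subtype.ext
  funext x
  have h : mfderiv I' I' (ContMDiffMap.id : C^∞⟮I', M'; I', M'⟯) x =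
    ContinuousLinearMap.id ℝ (TangentSpace I' x) := mfderiv_id
  ext v
  change w.1 x (fun i => mfderiv I' I' (ContMDiffMap.id : C^∞⟮I', M'; I', M'⟯) x (v i)) = w.1 x v
  rw [h]
  rfl

theorem contract_ofDeg_zero (V : Cₛ^∞⟮I'; E', (TangentSpace I' : M' → Type _)⟯)
    (w : DiffForm I' M' 0) : contract V (ofDeg I' 0 w) = 0 :=
  liftDeg_ofDeg _ 0 w

theorem contract_ofDeg_succ (V : Cₛ^∞⟮I'; E', (TangentSpace I' : M' → Type _)⟯) (n : ℕ)
    (w : DiffForm I' M' (n + 1)) :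
    contract V (ofDeg I' (n + 1) w) = ofDeg I' n (contractDeg V n w) :=
  liftDeg_ofDeg _ (n + 1) w

/-- Contractions with vector fields that are related by a smooth map commute with the
pull-back. -/
theorem pullback_contract [FiniteDimensional ℝ E] (f : C^∞⟮I, M; I', M'⟯)
    (V : Cₛ^∞⟮I; E, (TangentSpace I : M → Type _)⟯)
    (W : Cₛ^∞⟮I'; E', (TangentSpace I' : M' → Type _)⟯)
    (h : ∀ x, mfderiv I I' f x (V x) = W (f x)) (w : Omega I' M') :
    pullback f (contract W w) = contract V (pullback f w) := by
  suffices pullback f ∘ₗ contract W = contract V ∘ₗ pullback f from DFunLike.congr_fun this w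
  refine omega_hom_ext fun n w => ?_
  rw [LinearMap.comp_apply, LinearMap.comp_apply, pullback_ofDeg]
  rcases n with _ | n
  · rw [contract_ofDeg_zero, contract_ofDeg_zero, map_zero]
  · rw [contract_ofDeg_succ, contract_ofDeg_succ, pullback_ofDeg]
    congr 1
    apply Subtype.ext
    funext x
    change ((w.1 (f x)).curryLeft (W (f x))).compLinearMap (mfderiv I I' f x).toLinearMap =
      ((w.1 (f x)).compLinearMap (mfderiv I I' f x).toLinearMap).curryLeft (V x)
    rw [AlternatingMap.curryLeft_compLinearMap, ← h]
    rfl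

theorem contract_contract_self (V : Cₛ^∞⟮I'; E', (TangentSpace I' : M' → Type _)⟯)
    (w : Omega I' M') : contract V (contract V w) = 0 := by
  suffices contract V ∘ₗ contract V = 0 from DFunLike.congr_fun this w
  refine omega_hom_ext fun n w => ?_
  rw [LinearMap.comp_apply, LinearMap.zero_apply]
  rcases n with _ | _ | n
  · rw [contract_ofDeg_zero, map_zero]
  · rw [contract_ofDeg_succ, contract_ofDeg_zero]
  · rw [contract_ofDeg_succ, contract_ofDeg_succ]
    have : contractDeg V n (contractDeg V (n + 1) w) = 0 := by
      apply Subtype.ext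
      funext x
      exact AlternatingMap.curryLeft_same (w.1 x) (V x)
    rw [this, map_zero]

theorem contract_contract (V W : Cₛ^∞⟮I'; E', (TangentSpace I' : M' → Type _)⟯)
    (w : Omega I' M') : contract V (contract W w) = -contract W (contract V w) := by
  have h := contract_contract_self (V + W) w
  simp only [map_add, LinearMap.add_apply, contract_contract_self, zero_add, add_zero] at h
  rw [add_comm] at h
  exact eq_neg_of_add_eq_zero_left h

/-- The pairs of a form `v` on `M` and a form `w` on `M'` such that `v` and the pull-back of `w`
along `f` agree, as forms on the full tangent spaces of `M`, along the image of `s`. -/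
noncomputable def agreeAlong (f : C^∞⟮I, M; I', M'⟯) (s : C^∞⟮I', M'; I, M⟯) :
    Submodule ℂ (Omega I M × Omega I' M') :=
  Submodule.span ℂ {q | ∃ (n : ℕ) (v : DiffForm I M n) (w : DiffForm I' M' n),
    (∀ y, v.1 (s y) = (pullbackDeg f n w).1 (s y)) ∧ q = (ofDeg I n v, ofDeg I' n w)}

theorem pullback_mem_agreeAlong (f : C^∞⟮I, M; I', M'⟯) (s : C^∞⟮I', M'; I, M⟯)
    (w : Omega I' M') : (pullback f w, w) ∈ agreeAlong f s := by
  suffices (agreeAlong f s).comap ((pullback f).prod LinearMap.id) = ⊤ by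
    have hw : w ∈ (⊤ : Submodule ℂ (Omega I' M')) := trivial
    rw [← this] at hw
    exact hw
  suffices (agreeAlong f s).mkQ ∘ₗ ((pullback f).prod LinearMap.id) = 0 by
    rw [← LinearMap.ker_eq_top, LinearMap.ker_comp, Submodule.ker_mkQ] at this
    exact this
  refine omega_hom_ext fun n w => ?_
  rw [LinearMap.comp_apply, LinearMap.zero_apply, Submodule.mkQ_apply,
    Submodule.Quotient.mk_eq_zero]
  refine Submodule.subset_span ⟨n, pullbackDeg f n w, w, fun _ => rfl, ?_⟩
  exact Prod.ext (pullback_ofDeg f n w) rfl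

theorem pullback_eq_of_mem_agreeAlong [FiniteDimensional ℝ E] {f : C^∞⟮I, M; I', M'⟯}
    {s : C^∞⟮I', M'; I, M⟯} (hs : ∀ y, f (s y) = y) {q : Omega I M × Omega I' M'}
    (hq : q ∈ agreeAlong f s) : pullback s q.1 = q.2 := by
  suffices agreeAlong f s ≤ LinearMap.eqLocus (pullback s ∘ₗ LinearMap.fst ℂ _ _)
    (LinearMap.snd ℂ _ _) from this hq
  refine Submodule.span_le.2 ?_
  rintro _ ⟨n, v, w, h, rfl⟩
  change pullback s (ofDeg I n v) = ofDeg I' n w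
  have h1 : pullbackDeg s n v = pullbackDeg s n (pullbackDeg f n w) := by
    apply Subtype.ext
    funext y
    exact congrArg (fun z => AlternatingMap.compLinearMap z (mfderiv I' I s y).toLinearMap) (h y)
  rw [pullback_ofDeg, h1, ← pullback_ofDeg, ← pullback_ofDeg, ← LinearMap.comp_apply,
    ← pullback_comp, pullback_id _ hs, LinearMap.id_apply]

theorem contract_mem_agreeAlong [FiniteDimensional ℝ E] {f : C^∞⟮I, M; I', M'⟯}
    {s : C^∞⟮I', M'; I, M⟯}
    (V : Cₛ^∞⟮I; E, (TangentSpace I : M → Type _)⟯)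
    (W : Cₛ^∞⟮I'; E', (TangentSpace I' : M' → Type _)⟯)
    (h : ∀ y, mfderiv I I' f (s y) (V (s y)) = W (f (s y)))
    {q : Omega I M × Omega I' M'} (hq : q ∈ agreeAlong f s) :
    (contract V q.1, contract W q.2) ∈ agreeAlong f s := by
  suffices agreeAlong f s ≤ (agreeAlong f s).comap ((contract V).prodMap (contract W)) from this hq
  refine Submodule.span_le.2 ?_
  rintro _ ⟨n, v, w, hvw, rfl⟩
  change (contract V (ofDeg I n v), contract W (ofDeg I' n w)) ∈ agreeAlong f s
  rcases n with _ | n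
  · rw [contract_ofDeg_zero, contract_ofDeg_zero]
    exact Submodule.zero_mem _
  · rw [contract_ofDeg_succ, contract_ofDeg_succ]
    refine Submodule.subset_span ⟨n, _, _, fun y => ?_, rfl⟩
    change (v.1 (s y)).curryLeft (V (s y)) = ((w.1 (f (s y))).curryLeft (W (f (s y)))).compLinearMap
      (mfderiv I I' f (s y)).toLinearMap
    rw [hvw, ← h]
    exact AlternatingMap.curryLeft_compLinearMap _ _ _

end FormCalculus

section GroupAction

variable {F : Type*} [NormedAddCommGroup F] [NormedSpace ℝ F] [FiniteDimensional ℝ F]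
  {K : Type*} [TopologicalSpace K] {J : ModelWithCorners ℝ F K}
  {E : Type*} [NormedAddCommGroup E] [NormedSpace ℝ E] [FiniteDimensional ℝ E]
  {H : Type*} [TopologicalSpace H] {I : ModelWithCorners ℝ E H}
  {G : Type*} [TopologicalSpace G] [ChartedSpace K G] [Group G] [LieGroup J ∞ G]
  {M : Type*} [TopologicalSpace M] [ChartedSpace H M] [IsManifold I ∞ M]
  {E' : Type*} [NormedAddCommGroup E'] [NormedSpace ℝ E']
  {H' : Type*} [TopologicalSpace H'] {I' : ModelWithCorners ℝ E' H'}
  {M' : Type*} [TopologicalSpace M'] [ChartedSpace H' M'] [IsManifold I' ∞ M']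

theorem mfderiv_genField (A : C^∞⟮J.prod I, G × M; I, M⟯) (hA : ∀ x, A (1, x) = x)
    (f : C^∞⟮I, M; I', M'⟯) (a : GroupLieAlgebra J G) (x : M) :
    (mfderiv I I' f x (genField A hA a x) : E') =
      (mfderiv J I' (fun h : G => f (A (h, x))) 1 a : E') := by
  have hA1 : MDifferentiableAt J I (fun h : G => A (h, x)) 1 :=
    (A.contMDiff.comp (contMDiff_id.prodMk contMDiff_const)).mdifferentiable (by simp) 1
  have h1 : mfderiv J I' (fun h : G => f (A (h, x))) 1 =
      (mfderiv I I' f (A (1, x))).comp (mfderiv J I (fun h : G => A (h, x)) 1) :=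
    mfderiv_comp (I' := I) (1 : G) (f.contMDiff.mdifferentiable (by simp) _) hA1
  have h2 : ∀ y : M, y = x → (mfderiv I I' f y : E →L[ℝ] E') = (mfderiv I I' f x : E →L[ℝ] E') := by
    rintro y rfl; rfl
  have h3 := DFunLike.congr_fun (h2 (A (1, x)) (hA x)) (mfderiv J I (fun h : G => A (h, x)) 1 a : E)
  have h4 := DFunLike.congr_fun (show (_ : F →L[ℝ] E') = _ from h1) a
  exact h3.symm.trans h4.symm

theorem genField_congr (A : C^∞⟮J.prod I, G × M; I, M⟯) (hA : ∀ x, A (1, x) = x)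
    (a : GroupLieAlgebra J G) {x y : M} (h : x = y) :
    (genField A hA a x : E) = (genField A hA a y : E) := by
  subst h; rfl

variable [MulAction G M] [ContMDiffSMul J I ∞ G M]

variable (J I G M) in
theorem invAct_one (x : M) : invAct J G I M (1, x) = x := by simp [invAct]

variable (J I G M) in
theorem rightMul_one (x : G × M) : rightMul J I G M (1, x) = x := by simp [rightMul]

theorem contrForm_tmul (t : ℂ) (a : GroupLieAlgebra J G) (w : Omega I M) :
    contrForm J G I M (t ⊗ₜ a) w = t • contract (genField (invAct J G I M) (invAct_one J I G M) a) w := by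
  rw [contrForm, LinearMap.liftBaseChange_tmul]
  rfl

theorem contrLeft_tmul (t : ℂ) (a : GroupLieAlgebra J G) (w : Omega (J.prod I) (G × M)) :
    contrLeft J I G M (t ⊗ₜ a) w =
      t • contract (genField (rightMul J I G M) (rightMul_one J I G M) a) w := by
  rw [contrLeft, LinearMap.liftBaseChange_tmul]
  rfl

theorem contrForm_contrForm (a b : LieC J G) (w : Omega I M) :
    contrForm J G I M a (contrForm J G I M b w) =
      -contrForm J G I M b (contrForm J G I M a w) := by
  induction a using TensorProduct.induction_on with
  | zero => simp only [map_zero, LinearMap.zero_apply, neg_zero]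
  | add a a' ha ha' => simp only [map_add, LinearMap.add_apply, ha, ha', neg_add]
  | tmul s a =>
    induction b using TensorProduct.induction_on with
    | zero => simp only [map_zero, LinearMap.zero_apply, neg_zero]
    | add b b' hb hb' => simp only [map_add, LinearMap.add_apply, hb, hb', neg_add]
    | tmul t b =>
      rw [contrForm_tmul, contrForm_tmul, contrForm_tmul, contrForm_tmul, map_smul, map_smul,
        contract_contract, smul_neg, smul_neg, smul_comm]

theorem contrForm_contrForm_self (a : LieC J G) (w : Omega I M) :
    contrForm J G I M a (contrForm J G I M a w) = 0 := by
  have h := contrForm_contrForm a a w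
  have h2 : (2 : ℂ) • contrForm J G I M a (contrForm J G I M a w) = 0 := by
    rw [two_smul]
    nth_rw 1 [h]
    exact neg_add_cancel _
  exact (smul_eq_zero.1 h2).resolve_left two_ne_zero

theorem mfderiv_actMap_genField (g : G) (a : GroupLieAlgebra J G) (x : M) :
    (mfderiv I I (actMap J I M g⁻¹) x
      (genField (invAct J G I M) (invAct_one J I G M) (Ad J g a) x) : E) =
      (genField (invAct J G I M) (invAct_one J I G M) a (actMap J I M g⁻¹ x) : E) := by
  refine (mfderiv_genField _ _ _ _ _).trans ?_
  have hs : ContMDiff J I ∞ (fun h : G => actMap J I M g⁻¹ (invAct J G I M (h, x))) :=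
    (actMap J I M g⁻¹).contMDiff.comp
      ((invAct J G I M).contMDiff.comp (contMDiff_id.prodMk contMDiff_const))
  have h1 : mfderiv J I (fun k : G => actMap J I M g⁻¹ (invAct J G I M (g * k * g⁻¹, x))) 1 =
      (mfderiv J I (fun h : G => actMap J I M g⁻¹ (invAct J G I M (h, x))) (g * 1 * g⁻¹)).comp
        (mfderiv J J (fun k : G => g * k * g⁻¹) 1) :=
    mfderiv_comp (I' := J) (1 : G) (hs.mdifferentiable (by simp) _)
      ((contMDiff_conj J g).mdifferentiable (by simp) _)
  have h2 : ∀ h : G, h = 1 →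
      (mfderiv J I (fun h : G => actMap J I M g⁻¹ (invAct J G I M (h, x))) h : F →L[ℝ] E) =
      (mfderiv J I (fun h : G => actMap J I M g⁻¹ (invAct J G I M (h, x))) 1 : F →L[ℝ] E) := by
    rintro h rfl; rfl
  have h3 := DFunLike.congr_fun (h2 (g * 1 * g⁻¹) (by group)) (Ad J g a : F)
  have h4 := DFunLike.congr_fun (show (_ : F →L[ℝ] E) = _ from h1) a
  have h5 : (fun k : G => actMap J I M g⁻¹ (invAct J G I M (g * k * g⁻¹, x))) =
      fun k : G => invAct J G I M (k, actMap J I M g⁻¹ x) := by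
    funext k
    change g⁻¹ • (g * k * g⁻¹)⁻¹ • x = k⁻¹ • g⁻¹ • x
    rw [← mul_smul, ← mul_smul]
    congr 1
    group
  have h6 : (mfderiv J I (fun k : G => actMap J I M g⁻¹ (invAct J G I M (g * k * g⁻¹, x))) 1 :
      F →L[ℝ] E) =
    (mfderiv J I (fun k : G => invAct J G I M (k, actMap J I M g⁻¹ x)) 1 : F →L[ℝ] E) := by rw [h5]
  exact h3.symm.trans (h4.symm.trans (DFunLike.congr_fun h6 a))

theorem actForm_contrForm (g : G) (a : LieC J G) (w : Omega I M) :
    actForm J I M g (contrForm J G I M a w) =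
      contrForm J G I M (AdC J g a) (actForm J I M g w) := by
  induction a using TensorProduct.induction_on with
  | zero => simp only [map_zero, LinearMap.zero_apply]
  | add a a' ha ha' =>
    have : AdC J g (a + a') = AdC J g a + AdC J g a' := (AdC J g).toLinearMap.map_add a a'
    simp only [this, map_add, LinearMap.add_apply, ha, ha']
  | tmul s a =>
    have h : AdC J g (s ⊗ₜ a) = s ⊗ₜ Ad J g a := rfl
    rw [h, contrForm_tmul, contrForm_tmul, map_smul]
    congr 1
    exact pullback_contract _ _ _ (mfderiv_actMap_genField g a) w

variable (J I G M) in
/-- The action as a map on `G × M`, factored through the fibre product. -/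
noncomputable def muProj : C^∞⟮J.prod I, G × M; I, M⟯ :=
  (AssocSpace.mu J I G M).comp (AssocSpace.proj J I G M)

theorem muProj_sliceOne (m : M) : muProj J I G M (sliceOne J I G M m) = m := one_smul G m

theorem mfderiv_muProj_genField (a : GroupLieAlgebra J G) (m : M) :
    (mfderiv (J.prod I) I (muProj J I G M) (sliceOne J I G M m)
      (genField (rightMul J I G M) (rightMul_one J I G M) a (sliceOne J I G M m)) : E) =
      ((-genField (invAct J G I M) (invAct_one J I G M) a)
        (muProj J I G M (sliceOne J I G M m)) : E) := by
  refine (mfderiv_genField _ _ _ _ _).trans ?_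
  have e1 : ((-genField (invAct J G I M) (invAct_one J I G M) a)
      (muProj J I G M (sliceOne J I G M m)) : E) =
      -(mfderiv J I (fun h : G => invAct J G I M (h, m)) 1 a : E) :=
    congrArg Neg.neg (genField_congr (invAct J G I M) (invAct_one J I G M) a (muProj_sliceOne m))
  refine Eq.trans ?_ e1.symm
  let φ : G × G → M := fun q => q.1 • q.2⁻¹ • m
  have hφ : ContMDiff (J.prod J) I ∞ φ :=
    (contMDiff_smul (I := J) (I' := I) (n := ∞) (G := G) (M := M)).comp
      (contMDiff_fst.prodMk ((contMDiff_smul (I := J) (I' := I) (n := ∞) (G := G) (M := M)).comp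
        (contMDiff_snd.inv.prodMk contMDiff_const)))
  have hd : mfderiv J (J.prod J) (fun h : G => (h, h)) 1 =
      (ContinuousLinearMap.id ℝ F).prod (ContinuousLinearMap.id ℝ F) := by
    have := mfderiv_prodMk (I := J) (I' := J) (I'' := J) (x := (1 : G)) (f := fun h : G => h)
      (g := fun h : G => h) mdifferentiableAt_id mdifferentiableAt_id
    rw [this]
    have hid : mfderiv J J (fun h : G => h) 1 = ContinuousLinearMap.id ℝ F := mfderiv_id
    rw [hid]
    rfl
  have hc : mfderiv J I (fun h : G => φ (h, h)) 1 =
      (mfderiv (J.prod J) I φ (1, 1)).comp (mfderiv J (J.prod J) (fun h : G => (h, h)) 1) :=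
    mfderiv_comp (I' := J.prod J) (1 : G) (hφ.mdifferentiable (by simp) _)
      ((contMDiff_id.prodMk contMDiff_id).mdifferentiable (n := ∞) (by simp) _)
  have hconst : (fun h : G => φ (h, h)) = fun _ => m := by
    funext h
    exact smul_inv_smul h m
  rw [hconst, mfderiv_const, hd] at hc
  have hsum := mfderiv_prod_eq_add_apply (I := J) (I' := J) (I'' := I) (f := φ) (p := ((1, 1) : G × G))
    (v := ((a, a) : F × F)) (hφ.mdifferentiable (by simp) _)
  have hc' := DFunLike.congr_fun (show (_ : F →L[ℝ] E) = _ from hc) a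
  have e2 : (mfderiv J I (fun h : G => φ (h, 1)) 1 : F →L[ℝ] E) =
      (mfderiv J I (fun h : G => muProj J I G M (rightMul J I G M (h, sliceOne J I G M m))) 1 :
        F →L[ℝ] E) := by
    have : (fun h : G => φ (h, 1)) =
        fun h : G => muProj J I G M (rightMul J I G M (h, sliceOne J I G M m)) := by
      funext h
      change h • (1 : G)⁻¹ • m = (1 * h) • m
      rw [inv_one, one_smul, one_mul]
    rw [this]
  have e3 : (mfderiv J I (fun h : G => φ (1, h)) 1 : F →L[ℝ] E) =
      (mfderiv J I (fun h : G => invAct J G I M (h, m)) 1 : F →L[ℝ] E) := by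
    have : (fun h : G => φ (1, h)) = fun h : G => invAct J G I M (h, m) := by
      funext h
      exact one_smul G _
    rw [this]
  have e2' := DFunLike.congr_fun e2 a
  have e3' := DFunLike.congr_fun e3 a
  refine eq_neg_of_add_eq_zero_left ?_
  refine Eq.trans (congrArg₂ (fun x y : E => x + y) e2'.symm e3'.symm) ?_
  exact Eq.trans (α := E) (Eq.symm hsum) (Eq.symm hc')

theorem contrLeft_mem_agreeAlong (a : LieC J G)
    {q : Omega (J.prod I) (G × M) × Omega I M}
    (hq : q ∈ agreeAlong (muProj J I G M) (sliceOne J I G M)) :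
    (contrLeft J I G M a q.1, (-contrForm J G I M a) q.2) ∈
      agreeAlong (muProj J I G M) (sliceOne J I G M) := by
  induction a using TensorProduct.induction_on with
  | zero =>
    simp only [map_zero, LinearMap.zero_apply, neg_zero]
    exact Submodule.zero_mem _
  | add a a' ha ha' =>
    have h := Submodule.add_mem _ ha ha'
    simp only [map_add, LinearMap.add_apply, neg_add]
    exact h
  | tmul s a =>
    have h := contract_mem_agreeAlong _ _ (mfderiv_muProj_genField (I := I) (M := M) a) hq
    have h' := Submodule.smul_mem _ s h
    rw [map_neg] at h'
    rw [LinearMap.neg_apply, contrLeft_tmul, contrForm_tmul, ← smul_neg]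
    exact h'

theorem pullback_sliceOne_list_prod {κ : Type*} (e : κ → LieC J G) (l : List κ) (w : Omega I M) :
    pullback (sliceOne J I G M) ((l.map fun i => contrLeft J I G M (e i)).prod
      (pullback (AssocSpace.proj J I G M) (muPull J I G M w))) =
      (l.map fun i => -contrForm J G I M (e i)).prod w := by
  have h0 : pullback (AssocSpace.proj J I G M) (muPull J I G M w) = pullback (muProj J I G M) w := by
    rw [muProj, pullback_comp]
    rfl
  rw [h0]
  suffices ((l.map fun i => contrLeft J I G M (e i)).prod (pullback (muProj J I G M) w),
      (l.map fun i => -contrForm J G I M (e i)).prod w) ∈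
        agreeAlong (muProj J I G M) (sliceOne J I G M) from
    pullback_eq_of_mem_agreeAlong muProj_sliceOne this
  induction l with
  | nil => exact pullback_mem_agreeAlong _ _ w
  | cons i l ih =>
    rw [List.map_cons, List.map_cons, List.prod_cons, List.prod_cons]
    exact contrLeft_mem_agreeAlong (e i) ih

theorem muPull_actForm (g : G) (w : Omega I M) :
    muPull J I G M (actForm J I M g w) =
      actForm J I (AssocSpace J I G M) g (muPull J I G M w) := by
  rw [muPull, actForm, actForm, ← LinearMap.comp_apply, ← LinearMap.comp_apply, ← pullback_comp,
    ← pullback_comp]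
  congr 2
  ext x
  exact (AssocSpace.mu_smul J I G M g⁻¹ x).symm

variable (J I G M) in
/-- The inverse of `μ*`. -/
noncomputable def muPullInv : Omega I (AssocSpace J I G M) →ₗ[ℂ] Omega I M :=
  pullback ((AssocSpace.proj J I G M).comp (sliceOne J I G M))

theorem muPullInv_comp_muPull : muPullInv J I G M ∘ₗ muPull J I G M = LinearMap.id := by
  rw [muPullInv, muPull, ← pullback_comp]
  exact pullback_id _ fun x => one_smul G x

theorem muPull_comp_muPullInv : muPull J I G M ∘ₗ muPullInv J I G M = LinearMap.id := by
  rw [muPullInv, muPull, ← pullback_comp]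
  exact pullback_id _ fun x => AssocSpace.mk_act x

end GroupAction

section Clifford

open CliffordAlgebra

variable {V : Type*} [AddCommGroup V] [Module ℂ V] {Q Q' : QuadraticForm ℂ V}

theorem involute_ι_mul (v : V) (x : CliffordAlgebra Q) :
    involute (ι Q v * x) = -(ι Q v * involute x) := by
  rw [map_mul, involute_ι, neg_mul]

theorem involute_contractLeft (d : Module.Dual ℂ V) (x : CliffordAlgebra Q) :
    involute (contractLeft d x) = -contractLeft d (involute x) := by
  induction x using CliffordAlgebra.left_induction with
  | algebraMap r => simp
  | add x y hx hy => simp only [map_add, hx, hy, neg_add]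
  | ι_mul x v hx =>
    rw [contractLeft_ι_mul, involute_ι_mul, map_neg, contractLeft_ι_mul, map_sub, map_smul,
      involute_ι_mul, hx]
    simp

theorem changeForm_involute {b : LinearMap.BilinForm ℂ V} (h : b.toQuadraticMap = Q' - Q)
    (x : CliffordAlgebra Q) : changeForm h (involute x) = involute (changeForm h x) := by
  induction x using CliffordAlgebra.left_induction with
  | algebraMap r => simp
  | add x y hx hy => simp only [map_add, hx, hy]
  | ι_mul x v hx =>
    rw [involute_ι_mul, map_neg, changeForm_ι_mul, changeForm_ι_mul, map_sub, involute_ι_mul,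
      involute_contractLeft, hx]
    abel

theorem map_contractLeft (g : Q →qᵢ Q') (d : Module.Dual ℂ V) (d' : Module.Dual ℂ V)
    (h : ∀ v, d' (g v) = d v) (x : CliffordAlgebra Q) :
    CliffordAlgebra.map g (contractLeft d x) = contractLeft d' (CliffordAlgebra.map g x) := by
  induction x using CliffordAlgebra.left_induction with
  | algebraMap r => simp
  | add x y hx hy => simp only [map_add, hx, hy]
  | ι_mul x v hx =>
    rw [contractLeft_ι_mul, map_mul, map_apply_ι, contractLeft_ι_mul, map_sub, map_smul, map_mul,
      map_apply_ι, hx, h]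

theorem algebraMapInv_ι_mul (v : V) (x : ExteriorAlgebra ℂ V) :
    ExteriorAlgebra.algebraMapInv (ExteriorAlgebra.ι ℂ v * x) = 0 := by
  rw [map_mul, ExteriorAlgebra.algebraMapInv, ExteriorAlgebra.lift_ι_apply]
  simp

end Clifford

section Horizontal

variable {R : Type*} [Ring R] {κ : Type*}

theorem commute_list_prod_one_sub (F I : κ → R) (i : κ) (l : List κ) (hi : i ∉ l)
    (hFI : ∀ i j, i ≠ j → I i * F j = -(F j * I i)) (hI : ∀ i j, I i * I j = -(I j * I i)) :
    Commute (I i) (l.map fun j => 1 - F j * I j).prod := by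
  refine Commute.list_prod_right _ _ fun y hy => ?_
  obtain ⟨j, hj, rfl⟩ := List.mem_map.1 hy
  have hij : i ≠ j := fun h => hi (h ▸ hj)
  refine (Commute.one_right _).sub_right ?_
  change I i * (F j * I j) = F j * I j * I i
  rw [← mul_assoc, hFI i j hij, neg_mul, mul_assoc, hI i j, mul_neg, neg_neg, mul_assoc]

/-- A vector `z` with `I i z = -Γ i z` that is annihilated by the product of the `1 - F i I i`
vanishes. -/
theorem eq_zero_of_list_prod_one_sub {X : Type*} [AddCommGroup X] [Module R X] (F I Γ : κ → R)
    (hFI : ∀ i j, i ≠ j → I i * F j = -(F j * I i)) (hI : ∀ i j, I i * I j = -(I j * I i))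
    (hΓF : ∀ i j, Γ i * F j = -(F j * Γ i)) (hΓI : ∀ i j, Γ i * I j = -(I j * Γ i))
    (hF : ∀ i, F i * F i = 0)
    (z : X) (hz : ∀ i, I i • z = -(Γ i • z)) (l : List κ) (hl : l.Nodup)
    (h : (l.map fun j => 1 - F j * I j).prod • z = 0) : z = 0 := by
  induction l with
  | nil => simpa using h
  | cons i l ih =>
    rw [List.nodup_cons] at hl
    refine ih hl.2 ?_
    set P := (l.map fun j => 1 - F j * I j).prod with hP
    have hPI : Commute (I i) P := commute_list_prod_one_sub F I i l hl.1 hFI hI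
    have hPΓ : Commute (Γ i) P := by
      refine Commute.list_prod_right _ _ fun y hy => ?_
      obtain ⟨j, hj, rfl⟩ := List.mem_map.1 hy
      refine (Commute.one_right _).sub_right ?_
      change Γ i * (F j * I j) = F j * I j * Γ i
      rw [← mul_assoc, hΓF, neg_mul, mul_assoc, hΓI, mul_neg, neg_neg, mul_assoc]
    rw [List.map_cons, List.prod_cons, mul_smul, ← hP, sub_smul, one_smul, sub_eq_zero, mul_smul,
      ← mul_smul (I i), hPI.eq, mul_smul, hz, smul_neg, ← mul_smul P, ← hPΓ.eq, mul_smul,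
      smul_neg] at h
    have h2 : F i * Γ i * (F i * Γ i) = 0 := by
      rw [mul_assoc, ← mul_assoc (Γ i), hΓF, neg_mul, mul_neg, ← mul_assoc, ← mul_assoc, hF,
        zero_mul, zero_mul, neg_zero]
    rw [← mul_smul] at h
    rw [h, h, smul_neg, neg_neg, ← mul_smul, h2, zero_smul]

theorem list_prod_one_sub_mul (F I : κ → R) (hFI : ∀ i j, i ≠ j → I i * F j = -(F j * I i))
    (hFI' : ∀ i, I i * F i = 1 - F i * I i) (hF : ∀ i j, F i * F j = -(F j * F i))
    (hF' : ∀ i, F i * F i = 0) (l : List κ) (j : κ) (hj : j ∈ l) :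
    (l.map fun i => 1 - F i * I i).prod * F j = 0 := by
  classical
  induction l with
  | nil => simp at hj
  | cons i l ih =>
    rw [List.map_cons, List.prod_cons, mul_assoc]
    by_cases hjl : j ∈ l
    · rw [ih hjl, mul_zero]
    obtain rfl : j = i := (List.mem_cons.1 hj).resolve_right hjl
    have h : Commute (F j) (l.map fun i => 1 - F i * I i).prod := by
      refine Commute.list_prod_right _ _ fun y hy => ?_
      obtain ⟨i, hi, rfl⟩ := List.mem_map.1 hy
      have hij : i ≠ j := fun h => hjl (h ▸ hi)
      refine (Commute.one_right _).sub_right ?_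
      change F j * (F i * I i) = F i * I i * F j
      rw [mul_assoc, hFI i j hij, mul_neg, ← mul_assoc, ← mul_assoc, hF, neg_mul]
    rw [← h.eq, ← mul_assoc, sub_mul, mul_assoc (F j), hFI', mul_sub, mul_one, ← mul_assoc, hF',
      zero_mul, sub_zero, one_mul, sub_self, zero_mul]

end Horizontal

section Exterior

open CliffordAlgebra

variable {V : Type*} [AddCommGroup V] [Module ℂ V] {Ω : Type*} [AddCommGroup Ω] [Module ℂ Ω]

/-- The exterior multiplication by `v` on `Λ(V) ⊗ Ω`. -/
noncomputable def wedgeOp (Ω : Type*) [AddCommGroup Ω] [Module ℂ Ω] (v : V) :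
    Module.End ℂ (ExteriorAlgebra ℂ V ⊗[ℂ] Ω) :=
  (LinearMap.mulLeft ℂ (ExteriorAlgebra.ι ℂ v)).rTensor Ω

/-- The contraction with the functional `d` on `Λ(V) ⊗ Ω`. -/
noncomputable def contrOp (Ω : Type*) [AddCommGroup Ω] [Module ℂ Ω] (d : Module.Dual ℂ V) :
    Module.End ℂ (ExteriorAlgebra ℂ V ⊗[ℂ] Ω) :=
  (contractLeft (Q := (0 : QuadraticForm ℂ V)) d).rTensor Ω

/-- The operator `ε ⊗ t` on `Λ(V) ⊗ Ω`, where `ε` is the parity operator. -/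
noncomputable def parityOp (V : Type*) [AddCommGroup V] [Module ℂ V] (t : Module.End ℂ Ω) :
    Module.End ℂ (ExteriorAlgebra ℂ V ⊗[ℂ] Ω) :=
  TensorProduct.map (involute (Q := (0 : QuadraticForm ℂ V))).toLinearMap t

theorem wedgeOp_tmul (v : V) (x : ExteriorAlgebra ℂ V) (w : Ω) :
    wedgeOp Ω v (x ⊗ₜ w) = (ExteriorAlgebra.ι ℂ v * x) ⊗ₜ w := rfl

theorem contrOp_tmul (d : Module.Dual ℂ V) (x : ExteriorAlgebra ℂ V) (w : Ω) :
    contrOp Ω d (x ⊗ₜ w) = (contractLeft (Q := (0 : QuadraticForm ℂ V)) d x) ⊗ₜ w := rfl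

theorem parityOp_tmul (t : Module.End ℂ Ω) (x : ExteriorAlgebra ℂ V) (w : Ω) :
    parityOp V t (x ⊗ₜ w) = (involute (Q := (0 : QuadraticForm ℂ V)) x) ⊗ₜ t w := rfl

theorem contractLeft_zero_ι_mul (d : Module.Dual ℂ V) (v : V) (x : ExteriorAlgebra ℂ V) :
    contractLeft (Q := (0 : QuadraticForm ℂ V)) d (ExteriorAlgebra.ι ℂ v * x) =
      d v • x - ExteriorAlgebra.ι ℂ v * contractLeft (Q := (0 : QuadraticForm ℂ V)) d x :=
  contractLeft_ι_mul (Q := (0 : QuadraticForm ℂ V)) d v x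

theorem contrOp_mul_wedgeOp (d : Module.Dual ℂ V) (v : V) :
    contrOp Ω d * wedgeOp Ω v = algebraMap ℂ _ (d v) - wedgeOp Ω v * contrOp Ω d := by
  refine TensorProduct.ext' fun x w => ?_
  rw [Module.End.mul_apply, LinearMap.sub_apply, Module.End.mul_apply, wedgeOp_tmul, contrOp_tmul,
    contrOp_tmul, wedgeOp_tmul, contractLeft_zero_ι_mul, TensorProduct.sub_tmul,
    Module.algebraMap_end_apply, TensorProduct.smul_tmul']

theorem wedgeOp_mul_wedgeOp (u v : V) : wedgeOp Ω u * wedgeOp Ω v = -(wedgeOp Ω v * wedgeOp Ω u) := by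
  refine TensorProduct.ext' fun x w => ?_
  rw [Module.End.mul_apply, LinearMap.neg_apply, Module.End.mul_apply, wedgeOp_tmul, wedgeOp_tmul,
    wedgeOp_tmul, wedgeOp_tmul, ← mul_assoc, ← mul_assoc,
    eq_neg_of_add_eq_zero_left (ExteriorAlgebra.ι_add_mul_swap u v), neg_mul,
    TensorProduct.neg_tmul]

theorem wedgeOp_mul_self (v : V) : wedgeOp Ω v * wedgeOp Ω v = 0 := by
  refine TensorProduct.ext' fun x w => ?_
  rw [Module.End.mul_apply, wedgeOp_tmul, wedgeOp_tmul, ← mul_assoc, ExteriorAlgebra.ι_sq_zero,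
    zero_mul, TensorProduct.zero_tmul, LinearMap.zero_apply]

theorem contrOp_mul_contrOp (d d' : Module.Dual ℂ V) :
    contrOp Ω d * contrOp Ω d' = -(contrOp Ω d' * contrOp Ω d) := by
  refine TensorProduct.ext' fun x w => ?_
  rw [Module.End.mul_apply, LinearMap.neg_apply, Module.End.mul_apply, contrOp_tmul, contrOp_tmul,
    contrOp_tmul, contrOp_tmul, contractLeft_comm, TensorProduct.neg_tmul]

theorem parityOp_mul_wedgeOp (t : Module.End ℂ Ω) (v : V) :
    parityOp V t * wedgeOp Ω v = -(wedgeOp Ω v * parityOp V t) := by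
  refine TensorProduct.ext' fun x w => ?_
  rw [Module.End.mul_apply, LinearMap.neg_apply, Module.End.mul_apply, wedgeOp_tmul, parityOp_tmul,
    parityOp_tmul, wedgeOp_tmul, involute_ι_mul, TensorProduct.neg_tmul]

theorem parityOp_mul_contrOp (t : Module.End ℂ Ω) (d : Module.Dual ℂ V) :
    parityOp V t * contrOp Ω d = -(contrOp Ω d * parityOp V t) := by
  refine TensorProduct.ext' fun x w => ?_
  rw [Module.End.mul_apply, LinearMap.neg_apply, Module.End.mul_apply, contrOp_tmul, parityOp_tmul,
    parityOp_tmul, contrOp_tmul, involute_contractLeft, TensorProduct.neg_tmul]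

/-- The augmentation of `Λ(V) ⊗ Ω`. -/
noncomputable def augOp (V Ω : Type*) [AddCommGroup V] [Module ℂ V] [AddCommGroup Ω] [Module ℂ Ω] :
    ExteriorAlgebra ℂ V ⊗[ℂ] Ω →ₗ[ℂ] Ω :=
  (TensorProduct.lid ℂ Ω).toLinearMap ∘ₗ
    (ExteriorAlgebra.algebraMapInv (R := ℂ) (M := V)).toLinearMap.rTensor Ω

theorem augOp_tmul (x : ExteriorAlgebra ℂ V) (w : Ω) :
    augOp V Ω (x ⊗ₜ w) = ExteriorAlgebra.algebraMapInv x • w := rfl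

theorem augOp_wedgeOp (v : V) (z : ExteriorAlgebra ℂ V ⊗[ℂ] Ω) :
    augOp V Ω (wedgeOp Ω v z) = 0 := by
  suffices augOp V Ω ∘ₗ wedgeOp Ω v = 0 from DFunLike.congr_fun this z
  refine TensorProduct.ext' fun x w => ?_
  rw [LinearMap.comp_apply, wedgeOp_tmul, augOp_tmul, algebraMapInv_ι_mul, zero_smul,
    LinearMap.zero_apply]

variable {κ : Type*} [DecidableEq κ] {f : κ → V} {d : κ → Module.Dual ℂ V}

theorem list_prod_one_sub_mul_wedgeOp (hdf : ∀ i j, d i (f j) = if i = j then 1 else 0)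
    (l : List κ) (j : κ) (hj : j ∈ l) :
    (l.map fun i => 1 - wedgeOp Ω (f i) * contrOp Ω (d i)).prod * wedgeOp Ω (f j) = 0 := by
  refine list_prod_one_sub_mul (R := Module.End ℂ (ExteriorAlgebra ℂ V ⊗[ℂ] Ω))
    (fun i => wedgeOp Ω (f i)) (fun i => contrOp Ω (d i)) (fun i j hij => ?_) (fun i => ?_)
    (fun i j => wedgeOp_mul_wedgeOp _ _) (fun i => wedgeOp_mul_self _) l j hj
  · rw [contrOp_mul_wedgeOp, hdf, if_neg hij, map_zero]
    exact zero_sub (G := Module.End ℂ (ExteriorAlgebra ℂ V ⊗[ℂ] Ω)) _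
  · rw [contrOp_mul_wedgeOp, hdf, if_pos rfl, map_one]

/-- The product of the operators `1 - f i ∧ d i ⌋` over dual bases is the projection to degree
zero. -/
theorem list_prod_one_sub_apply (hdf : ∀ i j, d i (f j) = if i = j then 1 else 0)
    (hf : Submodule.span ℂ (Set.range f) = ⊤) (l : List κ) (hl : ∀ i, i ∈ l)
    (z : ExteriorAlgebra ℂ V ⊗[ℂ] Ω) :
    (l.map fun i => 1 - wedgeOp Ω (f i) * contrOp Ω (d i)).prod z = 1 ⊗ₜ augOp V Ω z := by
  set P := (l.map fun i => 1 - wedgeOp Ω (f i) * contrOp Ω (d i)).prod with hP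
  suffices P = (TensorProduct.mk ℂ (ExteriorAlgebra ℂ V) Ω 1) ∘ₗ augOp V Ω from
    DFunLike.congr_fun this z
  have hPv : ∀ v : V, P * wedgeOp Ω v = 0 := by
    intro v
    have hv : v ∈ Submodule.span ℂ (Set.range f) := hf ▸ trivial
    have hadd : ∀ u v : V, wedgeOp Ω (u + v) = wedgeOp Ω u + wedgeOp Ω v := fun u v => by
      refine TensorProduct.ext' fun x w => ?_
      rw [LinearMap.add_apply, wedgeOp_tmul, wedgeOp_tmul, wedgeOp_tmul, map_add, add_mul,
        TensorProduct.add_tmul]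
    have hsmul : ∀ (c : ℂ) (v : V), wedgeOp Ω (c • v) = c • wedgeOp Ω v := fun c v => by
      refine TensorProduct.ext' fun x w => ?_
      rw [LinearMap.smul_apply, wedgeOp_tmul, wedgeOp_tmul, map_smul, smul_mul_assoc,
        TensorProduct.smul_tmul']
    induction hv using Submodule.span_induction with
    | mem v hv =>
      obtain ⟨j, rfl⟩ := hv
      exact list_prod_one_sub_mul_wedgeOp hdf l j (hl j)
    | zero => rw [← zero_smul ℂ (0 : V), hsmul, zero_smul, mul_zero]
    | add u v _ _ hu hv => rw [hadd, mul_add, hu, hv, add_zero]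
    | smul c v _ hv => rw [hsmul, mul_smul_comm, hv, smul_zero]
  have hP1 : ∀ w : Ω, P (1 ⊗ₜ w) = 1 ⊗ₜ w := by
    intro w
    have hc : ∀ i, (1 - wedgeOp Ω (f i) * contrOp Ω (d i)) (1 ⊗ₜ w) = 1 ⊗ₜ w := fun i => by
      rw [LinearMap.sub_apply, Module.End.mul_apply, contrOp_tmul]
      have : contractLeft (Q := (0 : QuadraticForm ℂ V)) (d i) 1 = 0 := contractLeft_one _ _
      erw [this]
      rw [TensorProduct.zero_tmul, map_zero, sub_zero, Module.End.one_apply]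
    rw [hP]
    clear hl hPv hP
    induction l with
    | nil => rfl
    | cons i l ih => rw [List.map_cons, List.prod_cons, Module.End.mul_apply, ih, hc]
  refine TensorProduct.ext' fun x w => ?_
  rw [LinearMap.comp_apply, augOp_tmul]
  induction x using CliffordAlgebra.left_induction with
  | algebraMap r =>
    have : (algebraMap ℂ (ExteriorAlgebra ℂ V) r) ⊗ₜ[ℂ] w = 1 ⊗ₜ (r • w) := by
      rw [Algebra.algebraMap_eq_smul_one, TensorProduct.smul_tmul]
    erw [this]
    rw [hP1]
    erw [ExteriorAlgebra.algebraMap_leftInverse V r]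
    rfl
  | add x y hx hy => rw [TensorProduct.add_tmul, map_add, hx, hy, map_add, add_smul, map_add]
  | ι_mul x v hx =>
    erw [algebraMapInv_ι_mul]
    rw [zero_smul, map_zero]
    exact DFunLike.congr_fun (hPv v) (x ⊗ₜ w)

end Exterior

section Expansion

variable {V : Type*} [AddCommGroup V] [Module ℂ V] {Ω : Type*} [AddCommGroup Ω] [Module ℂ Ω]
  (b : LinearMap.BilinForm ℂ V) (c : V →ₗ[ℂ] Module.End ℂ Ω)

/-- The total contraction with `a` on `Λ(V) ⊗ Ω`. -/
noncomputable def totOp (a : V) : ExteriorAlgebra ℂ V ⊗[ℂ] Ω →ₗ[ℂ] ExteriorAlgebra ℂ V ⊗[ℂ] Ω :=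
  contrOp Ω (b a) + parityOp V (c a)

theorem totOp_wedgeOp (a v : V) (z : ExteriorAlgebra ℂ V ⊗[ℂ] Ω) :
    totOp b c a (wedgeOp Ω v z) = b a v • z - wedgeOp Ω v (totOp b c a z) := by
  have h1 : contrOp Ω (b a) (wedgeOp Ω v z) = b a v • z - wedgeOp Ω v (contrOp Ω (b a) z) :=
    DFunLike.congr_fun (contrOp_mul_wedgeOp (b a) v) z
  have h2 : parityOp V (c a) (wedgeOp Ω v z) = -wedgeOp Ω v (parityOp V (c a) z) :=
    DFunLike.congr_fun (parityOp_mul_wedgeOp (c a) v) z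
  rw [totOp, LinearMap.add_apply, LinearMap.add_apply, h1, h2, map_add]
  abel

variable {κ : Type*} [LinearOrder κ] (e f : κ → V)

/-- The sum of the `f_{s₁} ∧ ⋯ ∧ f_{sₚ} ⊗ (-1)ᵖ c_{sₚ} ⋯ c_{s₁} w` over the subsets of `A`. -/
noncomputable def expand (A : Finset κ) : Ω →ₗ[ℂ] ExteriorAlgebra ℂ V ⊗[ℂ] Ω :=
  ∑ S ∈ A.powerset, TensorProduct.mk ℂ _ _
    (((S.sort (· ≤ ·)).map fun i => ExteriorAlgebra.ι ℂ (f i)).prod) ∘ₗ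
      ((S.sort (· ≤ ·)).reverse.map fun i => -c (e i)).prod

theorem expand_empty (w : Ω) : expand c e f ∅ w = 1 ⊗ₜ w := by
  simp [expand]

theorem expand_insert {A : Finset κ} {i : κ} (hi : ∀ x ∈ A, i < x) (w : Ω) :
    expand c e f (insert i A) w = expand c e f A w - wedgeOp Ω (f i) (expand c e f A (c (e i) w)) := by
  have hiA : i ∉ A := fun h => lt_irrefl _ (hi i h)
  rw [expand, Finset.sum_powerset_insert hiA, LinearMap.add_apply, sub_eq_add_neg]
  congr 1
  rw [← map_neg, ← map_neg, expand, LinearMap.sum_apply, LinearMap.sum_apply, map_sum]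
  refine Finset.sum_congr rfl fun S hS => ?_
  have hS' : ∀ x ∈ S, i < x := fun x hx => hi x (Finset.mem_powerset.1 hS hx)
  rw [Finset.sort_insert _ (fun x hx => (hS' x hx).le) (fun h => lt_irrefl _ (hS' i h)),
    LinearMap.comp_apply, LinearMap.comp_apply, TensorProduct.mk_apply, TensorProduct.mk_apply,
    wedgeOp_tmul, List.map_cons, List.prod_cons, List.reverse_cons, List.map_append,
    List.prod_append]
  simp

theorem totOp_expand (hc : ∀ a a' w, c a (c a' w) = -c a' (c a w)) (hc' : ∀ a w, c a (c a w) = 0)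
    (A : Finset κ) (a : V) (w : Ω) :
    totOp b c a (expand c e f A w) =
      expand c e f A (c (a - ∑ i ∈ A, b a (f i) • e i) w) := by
  induction A using Finset.induction_on_min generalizing w with
  | empty =>
    rw [expand_empty, expand_empty, Finset.sum_empty, sub_zero, totOp, LinearMap.add_apply,
      contrOp_tmul, parityOp_tmul]
    have : CliffordAlgebra.contractLeft (Q := (0 : QuadraticForm ℂ V)) (b a) 1 = 0 :=
      CliffordAlgebra.contractLeft_one _ _
    erw [this]
    rw [map_one, TensorProduct.zero_tmul, zero_add]
  | insert i A hi ih =>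
    have hiA : i ∉ A := fun h => lt_irrefl _ (hi i h)
    rw [expand_insert c e f hi, expand_insert c e f hi, map_sub, totOp_wedgeOp, ih, ih,
      Finset.sum_insert hiA]
    have h1 : a - (b a (f i) • e i + ∑ i ∈ A, b a (f i) • e i) =
        a - (∑ i ∈ A, b a (f i) • e i) - b a (f i) • e i := by
      abel
    rw [h1]
    generalize a - ∑ i ∈ A, b a (f i) • e i = a'
    rw [map_sub c, map_smul c, LinearMap.sub_apply, LinearMap.smul_apply, map_sub (c (e i)),
      map_smul (c (e i)), hc', smul_zero, sub_zero, map_sub, map_smul, hc (e i) a', map_neg,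
      map_neg]
    abel

theorem augOp_expand (A : Finset κ) (w : Ω) : augOp V Ω (expand c e f A w) = w := by
  induction A using Finset.induction_on_min generalizing w with
  | empty =>
    rw [expand_empty, augOp_tmul, map_one, one_smul]
  | insert i A hi ih => rw [expand_insert c e f hi, map_sub, ih, augOp_wedgeOp, sub_zero]

/-- A horizontal element whose augmentation vanishes is zero. -/
theorem eq_zero_of_totOp_eq_zero [Fintype κ] {e f : κ → V}
    (hef : ∀ i j, b (e i) (f j) = if i = j then 1 else 0)
    (hf : Submodule.span ℂ (Set.range f) = ⊤)
    {U : Type*} [AddCommGroup U] [Module ℂ U] (z : U ⊗[ℂ] (ExteriorAlgebra ℂ V ⊗[ℂ] Ω))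
    (hz : ∀ a, (totOp b c a).lTensor U z = 0) (h0 : (augOp V Ω).lTensor U z = 0) : z = 0 := by
  let _ : Module (Module.End ℂ (ExteriorAlgebra ℂ V ⊗[ℂ] Ω)) (U ⊗[ℂ] (ExteriorAlgebra ℂ V ⊗[ℂ] Ω)) :=
    Module.compHom _ (Module.End.lTensorAlgHom ℂ (ExteriorAlgebra ℂ V ⊗[ℂ] Ω) U).toRingHom
  have hsmul : ∀ (t : Module.End ℂ (ExteriorAlgebra ℂ V ⊗[ℂ] Ω))
    (z : U ⊗[ℂ] (ExteriorAlgebra ℂ V ⊗[ℂ] Ω)), t • z = t.lTensor U z := fun _ _ => rfl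
  refine eq_zero_of_list_prod_one_sub (R := Module.End ℂ (ExteriorAlgebra ℂ V ⊗[ℂ] Ω))
    (fun i => wedgeOp Ω (f i)) (fun i => contrOp Ω (b (e i))) (fun i => parityOp V (c (e i)))
    (fun i j hij => ?_) (fun i j => contrOp_mul_contrOp _ _) (fun i j => parityOp_mul_wedgeOp _ _)
    (fun i j => parityOp_mul_contrOp _ _) (fun i => wedgeOp_mul_self _) z (fun i => ?_)
    Finset.univ.toList (Finset.nodup_toList _) ?_
  · rw [contrOp_mul_wedgeOp, hef, if_neg hij, map_zero]
    exact zero_sub (G := Module.End ℂ (ExteriorAlgebra ℂ V ⊗[ℂ] Ω)) _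
  · have h := hz (e i)
    rw [totOp, LinearMap.lTensor_add, LinearMap.add_apply] at h
    rw [hsmul, hsmul]
    exact eq_neg_of_add_eq_zero_left h
  · have h' : (Finset.univ.toList.map
        fun i => 1 - wedgeOp Ω (f i) * contrOp Ω (b (e i))).prod =
      TensorProduct.mk ℂ (ExteriorAlgebra ℂ V) Ω 1 ∘ₗ augOp V Ω := by
      refine LinearMap.ext fun z => ?_
      exact list_prod_one_sub_apply (d := fun i => b (e i)) hef hf Finset.univ.toList
        (by simp) z
    rw [hsmul]
    erw [h']
    rw [LinearMap.lTensor_comp, LinearMap.comp_apply, h0, map_zero]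

end Expansion

section CliffordMap

open CliffordAlgebra

variable {V : Type*} [AddCommGroup V] [Module ℂ V] {Q Q' : QuadraticForm ℂ V}

theorem changeForm_map {b : LinearMap.BilinForm ℂ V} (h : b.toQuadraticMap = Q' - Q)
    (g : Q →qᵢ Q) (g' : Q' →qᵢ Q') (hg : ∀ v, g' v = g v) (hb : ∀ v w, b (g v) (g w) = b v w)
    (x : CliffordAlgebra Q) :
    changeForm h (CliffordAlgebra.map g x) = CliffordAlgebra.map g' (changeForm h x) := by
  induction x using CliffordAlgebra.left_induction with
  | algebraMap r => simp
  | add x y hx hy => simp only [map_add, hx, hy]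
  | ι_mul x v hx =>
    rw [map_mul, map_apply_ι, changeForm_ι_mul, changeForm_ι_mul, map_sub, map_mul, map_apply_ι,
      hx, hg, map_contractLeft g' (b v) (b (g v)) (fun w => by rw [hg, hb])]

theorem involute_map (g : Q →qᵢ Q') (x : CliffordAlgebra Q) :
    involute (CliffordAlgebra.map g x) = CliffordAlgebra.map g (involute x) := by
  induction x using CliffordAlgebra.left_induction with
  | algebraMap r => simp
  | add x y hx hy => simp only [map_add, hx, hy]
  | ι_mul x v hx =>
    rw [map_mul, map_apply_ι, involute_ι_mul, involute_ι_mul, map_neg, map_mul, map_apply_ι, hx]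

theorem algebraMapInv_map (g : V →ₗ[ℂ] V) (x : ExteriorAlgebra ℂ V) :
    ExteriorAlgebra.algebraMapInv (ExteriorAlgebra.map g x) = ExteriorAlgebra.algebraMapInv x := by
  suffices (ExteriorAlgebra.algebraMapInv (R := ℂ) (M := V)).comp (ExteriorAlgebra.map g) =
    ExteriorAlgebra.algebraMapInv from DFunLike.congr_fun this x
  refine ExteriorAlgebra.hom_ext (LinearMap.ext fun v => ?_)
  simp [ExteriorAlgebra.algebraMapInv]

theorem equivExterior_map (g : Q →qᵢ Q) (x : CliffordAlgebra Q) :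
    equivExterior Q (CliffordAlgebra.map g x) =
      ExteriorAlgebra.map g.toLinearMap (equivExterior Q x) := by
  refine changeForm_map changeForm.associated_neg_proof g _ (fun _ => rfl) (fun v w => ?_) x
  rw [QuadraticMap.associated_apply, QuadraticMap.associated_apply, ← map_add]
  simp only [neg_apply, QuadraticMap.Isometry.map_app]

theorem equivExterior_involute (x : CliffordAlgebra Q) : equivExterior Q (involute x) =
    involute (Q := (0 : QuadraticForm ℂ V)) (equivExterior Q x) :=
  changeForm_involute changeForm.associated_neg_proof x

theorem equivExterior_contractLeft (d : Module.Dual ℂ V) (x : CliffordAlgebra Q) :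
    equivExterior Q (contractLeft d x) =
      contractLeft (Q := (0 : QuadraticForm ℂ V)) d (equivExterior Q x) :=
  changeForm_contractLeft changeForm.associated_neg_proof d x

end CliffordMap

section Weil

variable {F : Type*} [NormedAddCommGroup F] [NormedSpace ℝ F] [FiniteDimensional ℝ F]
  {K : Type*} [TopologicalSpace K] {J : ModelWithCorners ℝ F K}
  {E : Type*} [NormedAddCommGroup E] [NormedSpace ℝ E] [FiniteDimensional ℝ E]
  {H : Type*} [TopologicalSpace H] {I : ModelWithCorners ℝ E H}
  {G : Type*} [TopologicalSpace G] [ChartedSpace K G] [Group G] [LieGroup J ∞ G]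

namespace InvForm

variable (B : InvForm J G)

theorem symbol_AdCl (g : G) (x : B.Cl) :
    B.symbol (B.AdCl g x) = ExteriorAlgebra.map (AdC J g).toLinearMap (B.symbol x) :=
  equivExterior_map _ x

theorem symbol_involute (x : B.Cl) : B.symbol (CliffordAlgebra.involute x) =
    CliffordAlgebra.involute (Q := (0 : QuadraticForm ℂ (LieC J G))) (B.symbol x) :=
  equivExterior_involute x

theorem contrCl_apply (a : LieC J G) (x : B.Cl) :
    B.contrCl a x = CliffordAlgebra.contractLeft (B.form a) x := by
  refine B.symbol.symm_apply_eq.2 ?_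
  exact (equivExterior_contractLeft (B.form a) x).symm

theorem AdCl_contrCl (g : G) (a : LieC J G) (x : B.Cl) :
    B.AdCl g (B.contrCl a x) = B.contrCl (AdC J g a) (B.AdCl g x) := by
  rw [contrCl_apply, contrCl_apply]
  exact map_contractLeft _ _ _ (fun v => B.inv g a v) x

theorem augCl_AdCl (g : G) (x : B.Cl) : B.augCl (B.AdCl g x) = B.augCl x := by
  change ExteriorAlgebra.algebraMapInv (B.symbol (B.AdCl g x)) = _
  rw [symbol_AdCl]
  exact algebraMapInv_map _ _

theorem AdC_surjective (B : InvForm J G) (g : G) : Function.Surjective (AdC J g) := by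
  refine LinearMap.surjective_of_injective (f := (AdC J g).toLinearMap)
    ((injective_iff_map_eq_zero _).2 fun a ha => B.nondeg.1 a fun v => ?_)
  have ha' : AdC J g a = 0 := ha
  rw [← B.inv g, ha', map_zero, LinearMap.zero_apply]

/-- The basis of the Lie algebra that is dual to the given one with respect to the form. -/
noncomputable def dualVec (i : Fin (Module.finrank ℂ (LieC J G))) : LieC J G :=
  (B.form.toDual B.nondeg).symm ((Module.finBasis ℂ (LieC J G)).coord i)

theorem form_dualVec (a : LieC J G) (i : Fin (Module.finrank ℂ (LieC J G))) :
    B.form a (B.dualVec i) = (Module.finBasis ℂ (LieC J G)).coord i a := by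
  rw [← B.symm.eq]
  exact LinearMap.BilinForm.apply_toDual_symm_apply _ _

theorem sum_form_dualVec (a : LieC J G) :
    ∑ i, B.form a (B.dualVec i) • Module.finBasis ℂ (LieC J G) i = a := by
  simp only [form_dualVec]
  exact (Module.finBasis ℂ (LieC J G)).sum_repr a

theorem form_basis_dualVec (i j : Fin (Module.finrank ℂ (LieC J G))) :
    B.form (Module.finBasis ℂ (LieC J G) i) (B.dualVec j) = if i = j then 1 else 0 := by
  rw [form_dualVec, Module.Basis.coord_apply, Module.Basis.repr_self, Finsupp.single_apply]

theorem span_dualVec : Submodule.span ℂ (Set.range B.dualVec) = ⊤ := by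
  have h : B.dualVec =
      (Module.finBasis ℂ (LieC J G)).dualBasis.map (B.form.toDual B.nondeg).symm := by
    funext i
    simp [dualVec]
  rw [h]
  exact Module.Basis.span_eq _

theorem extDual_list_prod (l : List (Fin (Module.finrank ℂ (LieC J G)))) :
    B.extDual ((l.map fun i => ExteriorAlgebra.ι ℂ
      ((Module.finBasis ℂ (LieC J G)).coord i)).prod) =
      (l.map fun i => ExteriorAlgebra.ι ℂ (B.dualVec i)).prod := by
  rw [map_list_prod, List.map_map]
  congr 1
  refine List.map_congr_left fun i _ => ?_
  exact ExteriorAlgebra.map_apply_ι _ _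

variable (I) (M : Type*) [TopologicalSpace M] [ChartedSpace H M] [IsManifold I ∞ M]

/-- The space `𝒲(𝔤) ⊗ Ω(M)` in terms of the exterior algebra. -/
noncomputable def toExt : B.Weil ⊗[ℂ] Omega I M ≃ₗ[ℂ]
    EnvAlg J G ⊗[ℂ] (ExteriorAlgebra ℂ (LieC J G) ⊗[ℂ] Omega I M) :=
  TensorProduct.assoc ℂ (EnvAlg J G) B.Cl (Omega I M) ≪≫ₗ
    TensorProduct.congr (LinearEquiv.refl ℂ _) (TensorProduct.congr B.symbol (LinearEquiv.refl ℂ _))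

theorem augOp_toExt (z : B.Weil ⊗[ℂ] Omega I M) :
    (augOp (LieC J G) (Omega I M)).lTensor (EnvAlg J G) (B.toExt I M z) = B.Theta I M z := by
  suffices (augOp (LieC J G) (Omega I M)).lTensor (EnvAlg J G) ∘ₗ (B.toExt I M).toLinearMap =
    B.Theta I M from DFunLike.congr_fun this z
  refine TensorProduct.ext_threefold fun u x w => ?_
  change u ⊗ₜ[ℂ] (B.augCl x • w) = (B.augCl x • u) ⊗ₜ[ℂ] w
  rw [TensorProduct.smul_tmul]

variable [MulAction G M] [ContMDiffSMul J I ∞ G M]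

theorem toExt_contrTot (a : LieC J G) (z : B.Weil ⊗[ℂ] Omega I M) :
    B.toExt I M (B.contrTot I M a z) =
      (totOp B.form (contrForm J G I M) a).lTensor (EnvAlg J G) (B.toExt I M z) := by
  suffices (B.toExt I M).toLinearMap ∘ₗ B.contrTot I M a =
    (totOp B.form (contrForm J G I M) a).lTensor (EnvAlg J G) ∘ₗ (B.toExt I M).toLinearMap from
    DFunLike.congr_fun this z
  refine TensorProduct.ext_threefold fun u x w => ?_
  change u ⊗ₜ[ℂ] (B.symbol (B.symbol.symm (B.contrExt a (B.symbol x))) ⊗ₜ[ℂ] w) +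
    u ⊗ₜ[ℂ] (B.symbol (CliffordAlgebra.involute x) ⊗ₜ[ℂ] contrForm J G I M a w) =
    u ⊗ₜ[ℂ] (B.contrExt a (B.symbol x) ⊗ₜ[ℂ] w +
      CliffordAlgebra.involute (Q := (0 : QuadraticForm ℂ (LieC J G))) (B.symbol x) ⊗ₜ[ℂ]
        contrForm J G I M a w)
  rw [LinearEquiv.apply_symm_apply, symbol_involute, TensorProduct.tmul_add]

theorem evalAssoc_muPull (w : Omega I M) :
    TensorProduct.congr B.symbol (LinearEquiv.refl ℂ _) (B.evalAssoc I M (muPull J I G M w)) =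
      expand (contrForm J G I M) (Module.finBasis ℂ (LieC J G)) B.dualVec Finset.univ w := by
  have h : ∀ t : ExteriorAlgebra ℂ (Module.Dual ℂ (LieC J G)) ⊗[ℂ] Omega I M,
      TensorProduct.congr B.symbol (LinearEquiv.refl ℂ _)
        ((B.symbol.symm.toLinearMap ∘ₗ B.extDual.toLinearMap).rTensor (Omega I M) t) =
        B.extDual.toLinearMap.rTensor (Omega I M) t := by
    intro t
    suffices (TensorProduct.congr B.symbol (LinearEquiv.refl ℂ (Omega I M))).toLinearMap ∘ₗ
        (B.symbol.symm.toLinearMap ∘ₗ B.extDual.toLinearMap).rTensor (Omega I M) =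
        B.extDual.toLinearMap.rTensor (Omega I M) from DFunLike.congr_fun this t
    refine TensorProduct.ext' fun x w => ?_
    change B.symbol (B.symbol.symm (B.extDual x)) ⊗ₜ[ℂ] w = B.extDual x ⊗ₜ[ℂ] w
    rw [LinearEquiv.apply_symm_apply]
  rw [evalAssoc, LinearMap.comp_apply, LinearMap.comp_apply, h, evalOne, expand,
    Finset.powerset_univ, LinearMap.sum_apply, LinearMap.sum_apply, map_sum]
  refine Finset.sum_congr rfl fun S _ => ?_
  rw [LinearMap.comp_apply, LinearMap.comp_apply, LinearMap.comp_apply,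
    pullback_sliceOne_list_prod, TensorProduct.mk_apply, TensorProduct.mk_apply,
    LinearMap.rTensor_tmul]
  congr 1
  exact B.extDual_list_prod _

theorem toExt_psi_muStar (u : EnvAlg J G ⊗[ℂ] Omega I M) :
    B.toExt I M (B.psi I M (muStar J I G M u)) =
      (expand (contrForm J G I M) (Module.finBasis ℂ (LieC J G)) B.dualVec Finset.univ).lTensor
        (EnvAlg J G) u := by
  suffices (B.toExt I M).toLinearMap ∘ₗ B.psi I M ∘ₗ muStar J I G M =
      (expand (contrForm J G I M) (Module.finBasis ℂ (LieC J G)) B.dualVec Finset.univ).lTensor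
        (EnvAlg J G) from DFunLike.congr_fun this u
  refine TensorProduct.ext' fun u w => ?_
  rw [LinearMap.lTensor_tmul, ← evalAssoc_muPull]
  change TensorProduct.congr (LinearEquiv.refl ℂ _) _ (TensorProduct.assoc ℂ _ _ _
    ((TensorProduct.assoc ℂ _ _ _).symm (u ⊗ₜ[ℂ] B.evalAssoc I M (muPull J I G M w)))) = _
  rw [LinearEquiv.apply_symm_apply]
  rfl

theorem Theta_psi_muStar (u : EnvAlg J G ⊗[ℂ] Omega I M) :
    B.Theta I M (B.psi I M (muStar J I G M u)) = u := by
  rw [← augOp_toExt, toExt_psi_muStar, ← LinearMap.comp_apply, ← LinearMap.lTensor_comp]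
  have : augOp (LieC J G) (Omega I M) ∘ₗ expand (contrForm J G I M)
      (Module.finBasis ℂ (LieC J G)) B.dualVec Finset.univ = LinearMap.id :=
    LinearMap.ext fun w => augOp_expand _ _ _ _ w
  rw [this, LinearMap.lTensor_id, LinearMap.id_apply]

theorem contrTot_psi_muStar (a : LieC J G) (u : EnvAlg J G ⊗[ℂ] Omega I M) :
    B.contrTot I M a (B.psi I M (muStar J I G M u)) = 0 := by
  refine (B.toExt I M).map_eq_zero_iff.1 ?_
  rw [toExt_contrTot, toExt_psi_muStar, ← LinearMap.comp_apply, ← LinearMap.lTensor_comp]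
  have : totOp B.form (contrForm J G I M) a ∘ₗ expand (contrForm J G I M)
      (Module.finBasis ℂ (LieC J G)) B.dualVec Finset.univ = 0 := by
    refine LinearMap.ext fun w => ?_
    rw [LinearMap.comp_apply, totOp_expand _ _ _ _ contrForm_contrForm contrForm_contrForm_self,
      sum_form_dualVec, sub_self, map_zero, LinearMap.zero_apply, map_zero, LinearMap.zero_apply]
  rw [this, LinearMap.lTensor_zero, LinearMap.zero_apply]

variable {M}

theorem eq_of_Theta_eq {z z' : B.Weil ⊗[ℂ] Omega I M} (hz : ∀ a, B.contrTot I M a z = 0)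
    (hz' : ∀ a, B.contrTot I M a z' = 0) (h : B.Theta I M z = B.Theta I M z') : z = z' := by
  refine sub_eq_zero.1 ((B.toExt I M).map_eq_zero_iff.1 ?_)
  refine eq_zero_of_totOp_eq_zero B.form (contrForm J G I M) B.form_basis_dualVec B.span_dualVec _
    (fun a => ?_) ?_
  · rw [← toExt_contrTot, map_sub (B.contrTot I M a), hz, hz', sub_zero, map_zero]
  · rw [augOp_toExt, map_sub, h, sub_self]

theorem contrTot_AdC (g : G) (a : LieC J G) (z : B.Weil ⊗[ℂ] Omega I M) :
    B.contrTot I M (AdC J g a) (TensorProduct.map (B.AdWeil g) (actForm J I M g) z) =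
      TensorProduct.map (B.AdWeil g) (actForm J I M g) (B.contrTot I M a z) := by
  suffices B.contrTot I M (AdC J g a) ∘ₗ TensorProduct.map (B.AdWeil g) (actForm J I M g) =
      TensorProduct.map (B.AdWeil g) (actForm J I M g) ∘ₗ B.contrTot I M a from
    DFunLike.congr_fun this z
  refine TensorProduct.ext_threefold fun u x w => ?_
  rw [LinearMap.comp_apply, LinearMap.comp_apply, contrTot, contrTot, LinearMap.add_apply,
    LinearMap.add_apply, map_add]
  change (AdU J g u ⊗ₜ[ℂ] B.contrCl (AdC J g a) (B.AdCl g x)) ⊗ₜ[ℂ] actForm J I M g w +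
    (AdU J g u ⊗ₜ[ℂ] CliffordAlgebra.involute (B.AdCl g x)) ⊗ₜ[ℂ]
      contrForm J G I M (AdC J g a) (actForm J I M g w) =
    (AdU J g u ⊗ₜ[ℂ] B.AdCl g (B.contrCl a x)) ⊗ₜ[ℂ] actForm J I M g w +
    (AdU J g u ⊗ₜ[ℂ] B.AdCl g (CliffordAlgebra.involute x)) ⊗ₜ[ℂ]
      actForm J I M g (contrForm J G I M a w)
  have h : CliffordAlgebra.involute (B.AdCl g x) = B.AdCl g (CliffordAlgebra.involute x) :=
    involute_map _ x
  rw [AdCl_contrCl, actForm_contrForm, h]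

theorem Theta_AdWeil (g : G) (z : B.Weil ⊗[ℂ] Omega I M) :
    B.Theta I M (TensorProduct.map (B.AdWeil g) (actForm J I M g) z) =
      TensorProduct.map (AdU J g).toLinearMap (actForm J I M g) (B.Theta I M z) := by
  suffices B.Theta I M ∘ₗ TensorProduct.map (B.AdWeil g) (actForm J I M g) =
      TensorProduct.map (AdU J g).toLinearMap (actForm J I M g) ∘ₗ B.Theta I M from
    DFunLike.congr_fun this z
  refine TensorProduct.ext_threefold fun u x w => ?_
  change (B.augCl (B.AdCl g x) • AdU J g u) ⊗ₜ[ℂ] actForm J I M g w =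
    AdU J g (B.augCl x • u) ⊗ₜ[ℂ] actForm J I M g w
  rw [augCl_AdCl, map_smul]

theorem Theta_mem_invariants {z : B.Weil ⊗[ℂ] Omega I M} (hz : z ∈ B.basic I M) :
    B.Theta I M z ∈ invariants J I G M := fun g => by
  rw [← Theta_AdWeil, hz.2 g]

theorem psi_muStar_mem_basic {u : EnvAlg J G ⊗[ℂ] Omega I M} (hu : u ∈ invariants J I G M) :
    B.psi I M (muStar J I G M u) ∈ B.basic I M := by
  refine ⟨fun a => B.contrTot_psi_muStar I M a u, fun g => ?_⟩
  refine B.eq_of_Theta_eq I (fun a => ?_) (fun a => B.contrTot_psi_muStar I M a u) ?_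
  · obtain ⟨a', rfl⟩ := B.AdC_surjective g a
    rw [contrTot_AdC, contrTot_psi_muStar, map_zero]
  · rw [Theta_AdWeil, Theta_psi_muStar, hu g]

theorem psi_muStar_Theta {z : B.Weil ⊗[ℂ] Omega I M} (hz : z ∈ B.basic I M) :
    B.psi I M (muStar J I G M (B.Theta I M z)) = z :=
  B.eq_of_Theta_eq I (fun a => B.contrTot_psi_muStar I M a _) hz.1 (B.Theta_psi_muStar I M _)

end InvForm

variable {M : Type*} [TopologicalSpace M] [ChartedSpace H M] [IsManifold I ∞ M]
  [MulAction G M] [ContMDiffSMul J I ∞ G M]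

theorem muStar_AdU (g : G) (u : EnvAlg J G ⊗[ℂ] Omega I M) :
    muStar J I G M (TensorProduct.map (AdU J g).toLinearMap (actForm J I M g) u) =
      TensorProduct.map (AdU J g).toLinearMap (actForm J I (AssocSpace J I G M) g)
        (muStar J I G M u) := by
  suffices muStar J I G M ∘ₗ TensorProduct.map (AdU J g).toLinearMap (actForm J I M g) =
      TensorProduct.map (AdU J g).toLinearMap (actForm J I (AssocSpace J I G M) g) ∘ₗ
        muStar J I G M from DFunLike.congr_fun this u
  refine TensorProduct.ext' fun u w => ?_
  exact congrArg (fun v => AdU J g u ⊗ₜ[ℂ] v) (muPull_actForm g w)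

theorem bijOn_muStar : Set.BijOn (muStar J I G M) (invariants J I G M)
    (invariants J I G (AssocSpace J I G M)) := by
  have hinj : Function.Injective (muStar J I G M) := by
    refine Function.LeftInverse.injective (g := (muPullInv J I G M).lTensor (EnvAlg J G))
      fun u => ?_
    rw [muStar, ← LinearMap.comp_apply, ← LinearMap.lTensor_comp, muPullInv_comp_muPull,
      LinearMap.lTensor_id, LinearMap.id_apply]
  refine ⟨fun u hu g => ?_, hinj.injOn, fun v hv => ⟨(muPullInv J I G M).lTensor (EnvAlg J G) v, ?_⟩⟩
  · rw [← muStar_AdU, hu g]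
  · have h : muStar J I G M ((muPullInv J I G M).lTensor (EnvAlg J G) v) = v := by
      rw [muStar, ← LinearMap.comp_apply, ← LinearMap.lTensor_comp, muPull_comp_muPullInv,
        LinearMap.lTensor_id, LinearMap.id_apply]
    refine ⟨fun g => hinj ?_, h⟩
    rw [muStar_AdU, h, hv g]

end Weil

end EquivCoh

theorem lemma3p6
    {F : Type*} [NormedAddCommGroup F] [NormedSpace ℝ F] [FiniteDimensional ℝ F]
    {K : Type*} [TopologicalSpace K] (J : ModelWithCorners ℝ F K) [J.Boundaryless]
    {E : Type*} [NormedAddCommGroup E] [NormedSpace ℝ E] [FiniteDimensional ℝ E]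
    {H : Type*} [TopologicalSpace H] (I : ModelWithCorners ℝ E H) [I.Boundaryless]
    (G : Type*) [TopologicalSpace G] [ChartedSpace K G] [Group G] [LieGroup J ∞ G]
    (B : InvForm J G)
    (M : Type*) [TopologicalSpace M] [ChartedSpace H M] [IsManifold I ∞ M]
    [MulAction G M] [ContMDiffSMul J I ∞ G M] :
    Set.BijOn (B.Theta I M) (B.basic I M) (invariants J I G M) ∧
    (∀ (g : G) (w : Omega I M),
      muPull J I G M (actForm J I M g w) =
        actForm J I (AssocSpace J I G M) g (muPull J I G M w)) ∧
    Set.BijOn (muStar J I G M) (invariants J I G M)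
      (invariants J I G (AssocSpace J I G M)) ∧
    Set.MapsTo (B.psi I M) (invariants J I G (AssocSpace J I G M))
      (B.basic I M) ∧
    Set.InvOn (fun z => B.psi I M (muStar J I G M z)) (B.Theta I M)
      (B.basic I M) (invariants J I G M) := by
  refine ⟨⟨fun z hz => B.Theta_mem_invariants I hz, fun z hz z' hz' h =>
    B.eq_of_Theta_eq I hz.1 hz'.1 h, fun u hu => ⟨_, B.psi_muStar_mem_basic I hu,
      B.Theta_psi_muStar I M u⟩⟩, muPull_actForm, bijOn_muStar, fun v hv => ?_,
    fun z hz => B.psi_muStar_Theta I hz, fun u _ => B.Theta_psi_muStar I M u⟩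
  obtain ⟨u, hu, rfl⟩ := bijOn_muStar.surjOn hv
  exact B.psi_muStar_mem_basic I hu
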